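/- Let $\mathrm{sign}(t)=1$ for $t\ge 0$ and $\mathrm{sign}(t)=-1$ for $t<0$, and let $H_d$ be the class of functions $\mathrm{sign}(f)$ with $f$ a real univariate polynomial of degree at most $d$. A learner for $(\mathbb{R},H_d)$ with derivative queries is given $d\ge 1$, a parameter $\alpha$ and a sample of $n$ distinct points $x_1,\dots,x_n\in\mathbb{R}$ (listed in an arbitrary order), but not the polynomial $f$. It may send batches of queries to an oracle: a query names a sample point $x_j$ and an order $0\le k\le d-1$, and its answer is $\mathrm{sign}(f^{(k)}(x_j))$; all answers to a batch arrive together. The number of queries is the total size of all batches, and the number of rounds is the number of batches. Running time is counted in steps on a randomized real RAM: unit-cost addition, subtraction and comparison of integers, field operations and comparisons of reals (no rounding), indirect addressing, uniform draws from $\{0,\dots,m\}$, placing a query in the current batch, and sending a batch. **Theorem.** There are a randomized real RAM program $A$ and an absolute constant $C$ such that for all integers $d\ge 1$ and $n\ge 2$, all $\alpha\in(1/\log_2 n,\,1]$, all samples $S=\{x_1,\dots,x_n\}\subset\mathbb{R}$ of size $n$ and all polynomials $f$ of degree at most $d$, the program $A$, run on $(S,d,\alpha)$ with the derivative-query oracle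 of $f$, with probability one halts and outputs the correct labels $\mathrm{sign}(f(x_1)),\dots,\mathrm{sign}(f(x_n))$ of all sample points. Moreover, over the internal randomness of $A$, - the expected number of queries is at most $C\,\dfrac{d^3 n^{\alpha}}{\alpha}$; - the expected number of rounds is at most $1+\dfrac{2}{\alpha}$; - the expected running time is at most $C\,n\log_2 n$, and at most $C\,\dfrac{n}{\alpha}$ if the sample is listed in increasing order. -/

import Mathlib

open scoped ENNReal Polynomial

/-! A randomized real RAM with batched oracle queries, presented as a small imperative language
with a small-step (one unit of time per step) semantics.  The memory consists of arrays of natural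
numbers and arrays of real numbers, indexed by program constants and addressed indirectly.
Natural numbers support addition, truncated subtraction and comparison; real numbers support the
field operations and comparison (there is no rounding operation from reals to integers). -/

namespace RealRAM

/-- Natural-number expressions: constants, array cells, sum, truncated difference. -/
inductive NExp : Type
  | lit (c : ℕ) : NExp
  | cell (a : ℕ) (i : NExp) : NExp
  | plus (s t : NExp) : NExp
  | minus (s t : NExp) : NExp

/-- Real expressions: integers, array cells, and the field operations. -/
inductive RExp : Type
  | ofN (e : NExp) : RExp
  | cell (a : ℕ) (i : NExp) : RExp
  | plus (s t : RExp) : RExp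
  | minus (s t : RExp) : RExp
  | times (s t : RExp) : RExp
  | over (s t : RExp) : RExp

/-- Boolean tests. -/
inductive BExp : Type
  | leN (s t : NExp) : BExp
  | leR (s t : RExp) : BExp
  | neg (b : BExp) : BExp
  | conj (b c : BExp) : BExp

/-- Programs.
* `setN a i e`, `setR a i e`: write `e` to cell `i` of the natural / real array `a`.
* `rand a i e`: write a fresh uniformly random element of `{0, …, e}` to cell `i` of the natural
  array `a`.
* `ask a i k j`: add to the current batch the query for the sign of the `k`-th derivative of the
  hidden function at the `j`-th sample point; the answer will go to cell `i` of the natural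
  array `a`.
* `submit`: send the current batch to the oracle and receive all its answers. -/
inductive Cmd : Type
  | skip : Cmd
  | setN (a : ℕ) (i e : NExp) : Cmd
  | setR (a : ℕ) (i : NExp) (e : RExp) : Cmd
  | rand (a : ℕ) (i e : NExp) : Cmd
  | ask (a : ℕ) (i k j : NExp) : Cmd
  | submit : Cmd
  | seq (p q : Cmd) : Cmd
  | ite (b : BExp) (p q : Cmd) : Cmd
  | loop (b : BExp) (p : Cmd) : Cmd

/-- A query waiting in the current batch, with the cell that is to receive its answer. -/
structure Pending where
  arr : ℕ
  idx : ℕ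
  order : ℕ
  point : ℕ

/-- The memory, the current batch, and the three cost counters. -/
structure State where
  nat : ℕ → ℕ → ℕ
  real : ℕ → ℕ → ℝ
  batch : List Pending
  time : ℕ
  queries : ℕ
  rounds : ℕ

noncomputable section

/-- Value of a natural-number expression. -/
def NExp.eval (s : State) : NExp → ℕ
  | .lit c => c
  | .cell a i => s.nat a (i.eval s)
  | .plus e t => e.eval s + t.eval s
  | .minus e t => e.eval s - t.eval s

/-- Value of a real expression. -/
def RExp.eval (s : State) : RExp → ℝ
  | .ofN e => (e.eval s : ℝ)
  | .cell a i => s.real a (i.eval s)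
  | .plus e t => e.eval s + t.eval s
  | .minus e t => e.eval s - t.eval s
  | .times e t => e.eval s * t.eval s
  | .over e t => e.eval s / t.eval s

/-- Truth of a test. -/
def BExp.holds (s : State) : BExp → Prop
  | .leN e t => e.eval s ≤ t.eval s
  | .leR e t => e.eval s ≤ t.eval s
  | .neg b => ¬ b.holds s
  | .conj b c => b.holds s ∧ c.holds s

/-- Write to a cell of a natural-number array. -/
def State.writeN (s : State) (a i v : ℕ) : State :=
  { s with nat := Function.update s.nat a (Function.update (s.nat a) i v) }

/-- Write to a cell of a real array. -/
def State.writeR (s : State) (a i : ℕ) (v : ℝ) : State :=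
  { s with real := Function.update s.real a (Function.update (s.real a) i v) }

/-- Add a query to the current batch. -/
def State.enqueue (s : State) (q : Pending) : State :=
  { s with batch := s.batch ++ [q] }

/-- Send the batch to the oracle `O` (derivative order, index of the sample point ↦ answer):
this is one round, costs as many queries as the batch has entries, and stores all answers. -/
def State.send (O : ℕ → ℕ → ℕ) (s : State) : State :=
  let s' := s.batch.foldl (fun t q => t.writeN q.arr q.idx (O q.order q.point)) s
  { s' with batch := [], queries := s.queries + s.batch.length, rounds := s.rounds + 1 }

/-- One more unit of time. -/
def State.tick (s : State) : State := { s with time := s.time + 1 }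

/-- A configuration: the commands still to be executed, and the state.
The machine has halted when nothing is left to execute. -/
structure Config where
  todo : List Cmd
  state : State

open Classical in
/-- One step of the machine, taking one unit of time.  The oracle `O` is consulted by `submit`
only, and randomness is used by `rand` only; a halted configuration no longer changes. -/
def step (O : ℕ → ℕ → ℕ) (c : Config) : PMF Config :=
  let s := c.state
  match c.todo with
  | [] => PMF.pure c
  | .skip :: k => PMF.pure ⟨k, s.tick⟩
  | .setN a i e :: k => PMF.pure ⟨k, (s.writeN a (i.eval s) (e.eval s)).tick⟩
  | .setR a i e :: k => PMF.pure ⟨k, (s.writeR a (i.eval s) (e.eval s)).tick⟩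
  | .rand a i e :: k =>
      (PMF.uniformOfFintype (Fin (e.eval s + 1))).map fun v =>
        ⟨k, (s.writeN a (i.eval s) v).tick⟩
  | .ask a i r j :: k =>
      PMF.pure ⟨k, (s.enqueue ⟨a, i.eval s, r.eval s, j.eval s⟩).tick⟩
  | .submit :: k => PMF.pure ⟨k, (s.send O).tick⟩
  | .seq p q :: k => PMF.pure ⟨p :: q :: k, s.tick⟩
  | .ite b p q :: k => PMF.pure ⟨(if b.holds s then p else q) :: k, s.tick⟩
  | .loop b p :: k => PMF.pure ⟨if b.holds s then p :: .loop b p :: k else k, s.tick⟩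

/-- The random configuration after `T` steps. -/
def run (O : ℕ → ℕ → ℕ) (c : Config) : ℕ → PMF Config
  | 0 => PMF.pure c
  | T + 1 => (run O c T).bind (step O)

/-- The initial configuration of the program `P` for a learner of degree-`d` polynomial threshold
functions with parameter `α` on the sample `x`: natural array `0` holds `n, d`, real array `0`
holds the sample, cell `0` of real array `1` holds `α`, and every other cell is `0`. -/
def init (P : Cmd) (d : ℕ) (α : ℝ) {n : ℕ} (x : Fin n → ℝ) : Config where
  todo := [P]
  state :=
    { nat := fun a i => if a = 0 ∧ i = 0 then n else if a = 0 ∧ i = 1 then d else 0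
      real := fun a i =>
        if a = 0 then (if h : i < n then x ⟨i, h⟩ else 0) else if a = 1 ∧ i = 0 then α else 0
      batch := []
      time := 0
      queries := 0
      rounds := 0 }

/-- The sign of a real number with the convention `sign 0 = +1`, encoded as a bit:
`1` stands for `+1` and `0` stands for `-1`. -/
def signBit (r : ℝ) : ℕ := open Classical in if 0 ≤ r then 1 else 0

/-- The oracle for derivative queries: it reveals `sign (f^(k) (x_j))` for the sample points `x_j`
and the orders `0 ≤ k ≤ d - 1`.  Any other query gets the uninformative answer `0`. -/
def derivOracle (d : ℕ) {n : ℕ} (x : Fin n → ℝ) (f : ℝ[X]) (k j : ℕ) : ℕ :=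
  if h : k < d ∧ j < n then signBit ((Polynomial.derivative^[k] f).eval (x ⟨j, h.2⟩)) else 0

/-- The random configuration after `T` steps of the learner `P` on the sample `x` against the
hidden polynomial `f`. -/
def learn (P : Cmd) (d : ℕ) (α : ℝ) {n : ℕ} (x : Fin n → ℝ) (f : ℝ[X]) (T : ℕ) : PMF Config :=
  run (derivOracle d x f) (init P d α x) T

/-- With probability one, the learner halts and cells `0, …, n - 1` of natural array `1`
then hold the labels of all `n` sample points. -/
def LabelsPerfectly (P : Cmd) (d : ℕ) (α : ℝ) {n : ℕ} (x : Fin n → ℝ) (f : ℝ[X]) : Prop :=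
  ⨆ T : ℕ, (learn P d α x f T).toOuterMeasure
    {c | c.todo = [] ∧ ∀ j : Fin n, c.state.nat 1 j = signBit (f.eval (x j))} = 1

/-- The expectation of the final value of a (never decreasing) cost counter. -/
def expectedCost (cost : State → ℕ) (P : Cmd) (d : ℕ) (α : ℝ) {n : ℕ} (x : Fin n → ℝ)
    (f : ℝ[X]) : ℝ≥0∞ :=
  ⨆ T : ℕ, ∑' c : Config, learn P d α x f T c * (cost c.state : ℝ≥0∞)

end

end RealRAM

/-! The program never executes `rand`, so the expectations are values of a single run. Let `L` be
the rounded-up binary logarithm of `n` and `κ = ⌈α L⌉`; the branching factor `2 ^ κ` is at most `4 n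
^ α`.

Two facts about polynomials carry the theorem. If all derivatives of order below `d` have equal
signs at both ends of an interval, then `f` has constant sign on it: inductively `f'` has constant
sign there, so `f` is monotone with equal signs at the ends (`nonneg_iff_of_derivatives`).
Conversely, agreement at the ends rarely fails: a sign change of a derivative between neighbors of a
grid needs a root between them, a root serves at most two neighboring intervals, and there are `d`
derivatives with at most `d` roots each. So at most `2 d ^ 2` grid intervals have differing ends
(`fewChanges_derivOracle`).

The search therefore works on the sorted sample with grids of widths `2 ^ L`, `2 ^ (L - κ)`, ...,
`1`. A round splits each undecided interval into at most `2 ^ κ` pieces, queries all derivatives at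
the ends of the pieces in one batch, and labels the pieces whose ends agree. At most `2 d ^ 2 + 1`
intervals are undecided on any grid, the extra one being the last, which overhangs the sample. A
round thus costs at most `6 d ^ 3 2 ^ κ` queries, and `⌈L / κ⌉ ≤ 1 + 1 / α` rounds suffice.

A round takes linear time provided that `d ^ 3 2 ^ κ ≤ n`. If this fails, asking for all `n` labels
at once is already within the query budget. Merge sort adds time of order `n L` and is omitted when
a linear scan finds the sample in order.

The formal proof describes each command by `TerminatesIn`, a Hoare-style statement with a time
bound, whose specifications are combined in `learner_spec`. -/

namespace RealRAM

/-! ### Deterministic runs of programs with time bounds -/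

/-- The state `s` with its clock set to `τ`. -/
def State.atTime (s : State) (τ : ℕ) : State := { s with time := τ }

/-- Started in `s`, the command `p` makes no random choice and is executed completely after at
most `t` steps, in a state that satisfies `Q` up to the value of the clock. -/
def TerminatesIn (O : ℕ → ℕ → ℕ) (p : Cmd) (s : State) (t : ℕ) (Q : State → Prop) : Prop :=
  ∃ s' t', t' ≤ t ∧ Q s' ∧
    ∀ k τ, run O ⟨p :: k, s.atTime τ⟩ t' = PMF.pure ⟨k, s'.atTime (τ + t')⟩

/-- The content of row `a` of the natural memory after the answers to the batch `l` arrived. -/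
def answerRow (O : ℕ → ℕ → ℕ) (a : ℕ) (l : List Pending) (r : ℕ → ℕ) : ℕ → ℕ :=
  l.foldl (fun r q => if q.arr = a then Function.update r q.idx (O q.order q.point) else r) r

section Semantics

variable {O : ℕ → ℕ → ℕ} {s : State} {p q : Cmd} {t u : ℕ} {Q R : State → Prop}

theorem run_add (c : Config) (a b : ℕ) :
    run O c (a + b) = (run O c a).bind fun c' => run O c' b := by
  induction b with
  | zero => simp [run]
  | succ b ih => rw [← Nat.add_assoc, run, ih, PMF.bind_bind]; rfl

theorem run_add_of_pure {c c' : Config} {a : ℕ} (h : run O c a = PMF.pure c') (b : ℕ) :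
    run O c (a + b) = run O c' b := by
  rw [run_add, h, PMF.pure_bind]

theorem run_one (c : Config) : run O c 1 = step O c := by
  simp [run]

theorem run_halted (s : State) (T : ℕ) : run O ⟨[], s⟩ T = PMF.pure ⟨[], s⟩ := by
  induction T with
  | zero => rfl
  | succ T ih => rw [run, ih, PMF.pure_bind]; rfl

@[simp] theorem NExp.eval_atTime (e : NExp) (τ : ℕ) : e.eval (s.atTime τ) = e.eval s := by
  induction e with
  | lit c => rfl
  | cell a i ih => simp only [NExp.eval, ih]; rfl
  | plus a b iha ihb => simp [NExp.eval, iha, ihb]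
  | minus a b iha ihb => simp [NExp.eval, iha, ihb]

@[simp] theorem RExp.eval_atTime (e : RExp) (τ : ℕ) : e.eval (s.atTime τ) = e.eval s := by
  induction e with
  | ofN e => simp [RExp.eval]
  | cell a i => simp [RExp.eval]; rfl
  | _ a b iha ihb => simp [RExp.eval, iha, ihb]

@[simp] theorem BExp.holds_atTime (b : BExp) (τ : ℕ) :
    b.holds (s.atTime τ) ↔ b.holds s := by
  induction b with
  | leN a b => simp [BExp.holds]
  | leR a b => simp [BExp.holds]
  | neg b ih => simp [BExp.holds, ih]
  | conj a b iha ihb => simp [BExp.holds, iha, ihb]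

/-- Answers addressed to different arrays do not interact, so a batch can be studied one array at a
time through `answerRow`. -/
theorem foldl_answers (l : List Pending) (s : State) :
    l.foldl (fun t q => t.writeN q.arr q.idx (O q.order q.point)) s =
      { s with nat := fun a => answerRow O a l (s.nat a) } := by
  induction l generalizing s with
  | nil => rfl
  | cons q l ih =>
    rw [List.foldl_cons, ih]
    simp only [State.writeN, answerRow, List.foldl_cons, State.mk.injEq, and_true]
    funext a
    by_cases h : q.arr = a
    · subst h; simp
    · simp [h, Function.update_of_ne (Ne.symm h)]

theorem send_eq (s : State) : s.send O =
    { s with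
      nat := fun a => answerRow O a s.batch (s.nat a)
      batch := []
      queries := s.queries + s.batch.length
      rounds := s.rounds + 1 } := by
  simp [State.send, foldl_answers]

theorem send_atTime (s : State) (τ : ℕ) : (s.atTime τ).send O = (s.send O).atTime τ := by
  simp [send_eq, State.atTime]

theorem answerRow_append (a : ℕ) (l l' : List Pending) (r : ℕ → ℕ) :
    answerRow O a (l ++ l') r = answerRow O a l' (answerRow O a l r) := by
  simp [answerRow, List.foldl_append]

theorem TerminatesIn.mono (h : TerminatesIn O p s t Q) (htu : t ≤ u) (hQ : ∀ s, Q s → R s) :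
    TerminatesIn O p s u R := by
  obtain ⟨s', t', ht, hs, hr⟩ := h
  exact ⟨s', t', ht.trans htu, hQ _ hs, hr⟩

theorem TerminatesIn.le (h : TerminatesIn O p s t Q) (htu : t ≤ u) : TerminatesIn O p s u Q :=
  h.mono htu fun _ => id

theorem terminatesIn_of_step (s' : State) (hQ : Q s')
    (h : ∀ k τ, step O ⟨p :: k, s.atTime τ⟩ = PMF.pure ⟨k, s'.atTime (τ + 1)⟩) :
    TerminatesIn O p s 1 Q :=
  ⟨s', 1, le_rfl, hQ, fun k τ => by rw [run_one, h]⟩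

theorem terminatesIn_skip (h : Q s) : TerminatesIn O .skip s 1 Q :=
  terminatesIn_of_step s h fun _ _ => rfl

theorem terminatesIn_setN {a : ℕ} {i e : NExp} (h : Q (s.writeN a (i.eval s) (e.eval s))) :
    TerminatesIn O (.setN a i e) s 1 Q :=
  terminatesIn_of_step _ h fun _ _ => by simp [step]; rfl

theorem terminatesIn_ask {a : ℕ} {i k j : NExp}
    (h : Q (s.enqueue ⟨a, i.eval s, k.eval s, j.eval s⟩)) :
    TerminatesIn O (.ask a i k j) s 1 Q :=
  terminatesIn_of_step _ h fun _ _ => by simp [step]; rfl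

theorem terminatesIn_submit (h : Q (s.send O)) : TerminatesIn O .submit s 1 Q :=
  terminatesIn_of_step _ h fun _ _ => by simp only [step, send_atTime]; rfl

theorem TerminatesIn.seq (h : TerminatesIn O p s t fun s' => TerminatesIn O q s' u Q) :
    TerminatesIn O (.seq p q) s (1 + t + u) Q := by
  obtain ⟨s₁, t₁, ht₁, ⟨s₂, t₂, ht₂, hQ, h₂⟩, h₁⟩ := h
  refine ⟨s₂, 1 + t₁ + t₂, by omega, hQ, fun k τ => ?_⟩
  have h0 : run O ⟨.seq p q :: k, s.atTime τ⟩ 1 =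
      PMF.pure ⟨p :: q :: k, s.atTime (τ + 1)⟩ := by rw [run_one]; rfl
  rw [Nat.add_assoc, run_add_of_pure h0, run_add_of_pure (h₁ _ _), h₂, Nat.add_assoc,
    Nat.add_assoc]

theorem TerminatesIn.andThen (h : TerminatesIn O p s t R)
    (h' : ∀ s', R s' → TerminatesIn O q s' u Q) : TerminatesIn O (.seq p q) s (1 + t + u) Q :=
  .seq (h.mono le_rfl h')

theorem TerminatesIn.ite {b : BExp} (hp : b.holds s → TerminatesIn O p s t Q)
    (hq : ¬ b.holds s → TerminatesIn O q s t Q) : TerminatesIn O (.ite b p q) s (1 + t) Q := by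
  classical
  have h0 (k : List Cmd) (τ : ℕ) : run O ⟨.ite b p q :: k, s.atTime τ⟩ 1 =
      PMF.pure ⟨(if b.holds s then p else q) :: k, s.atTime (τ + 1)⟩ := by
    rw [run_one]; simp only [step, BExp.holds_atTime]; congr 2
  have h : TerminatesIn O (if b.holds s then p else q) s t Q := by
    split_ifs with hb
    exacts [hp hb, hq hb]
  obtain ⟨s', t', ht, hQ, hr⟩ := h
  refine ⟨s', 1 + t', by omega, hQ, fun k τ => ?_⟩
  rw [run_add_of_pure (h0 k τ), hr, Nat.add_assoc]

theorem TerminatesIn.loop_true {b : BExp} (hb : b.holds s)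
    (h : TerminatesIn O p s t fun s' => TerminatesIn O (.loop b p) s' u Q) :
    TerminatesIn O (.loop b p) s (t + 1 + u) Q := by
  obtain ⟨s₁, t₁, ht₁, ⟨s₂, t₂, ht₂, hQ, h₂⟩, h₁⟩ := h
  refine ⟨s₂, 1 + t₁ + t₂, by omega, hQ, fun k τ => ?_⟩
  have h0 : run O ⟨.loop b p :: k, s.atTime τ⟩ 1 =
      PMF.pure ⟨p :: .loop b p :: k, s.atTime (τ + 1)⟩ := by
    rw [run_one]; simp only [step, BExp.holds_atTime, hb, if_true]; rfl
  rw [Nat.add_assoc, run_add_of_pure h0, run_add_of_pure (h₁ _ _), h₂, Nat.add_assoc,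
    Nat.add_assoc]

theorem TerminatesIn.loop_false {b : BExp} (hb : ¬ b.holds s) (hQ : Q s) :
    TerminatesIn O (.loop b p) s 1 Q :=
  terminatesIn_of_step s hQ fun k τ => by
    simp only [step, BExp.holds_atTime, hb, if_false]; rfl

/-- A loop that is known to be traversed `N` times. -/
theorem TerminatesIn.loop {b : BExp} (I : ℕ → State → Prop) (N : ℕ) (τ : ℕ → ℕ)
    (h0 : I 0 s) (hb : ∀ i < N, ∀ s, I i s → b.holds s)
    (hbody : ∀ i < N, ∀ s, I i s → TerminatesIn O p s (τ i) (I (i + 1)))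
    (hend : ∀ s, I N s → ¬ b.holds s) :
    TerminatesIn O (.loop b p) s (∑ i ∈ Finset.range N, (τ i + 1) + 1) (I N) := by
  induction N generalizing I s τ with
  | zero => exact .loop_false (hend _ h0) h0
  | succ N ih =>
    have h1 := hbody 0 (by omega) s h0
    refine (TerminatesIn.loop_true (hb 0 (by omega) s h0)
      (h1.mono le_rfl fun s' hs' => ih (fun i => I (i + 1)) (fun i => τ (i + 1)) hs'
        (fun i hi => hb (i + 1) (by omega)) (fun i hi => hbody (i + 1) (by omega)) hend)).le ?_
    rw [Finset.sum_range_succ' _ N]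
    omega

/-- A loop that is traversed `N` times, with a uniform bound for the time of one traversal. -/
theorem TerminatesIn.loop_const {b : BExp} (I : ℕ → State → Prop) (N t : ℕ)
    (h0 : I 0 s) (hb : ∀ i < N, ∀ s, I i s → b.holds s)
    (hbody : ∀ i < N, ∀ s, I i s → TerminatesIn O p s t (I (i + 1)))
    (hend : ∀ s, I N s → ¬ b.holds s) :
    TerminatesIn O (.loop b p) s (N * (t + 1) + 1) (I N) :=
  (TerminatesIn.loop I N (fun _ => t) h0 hb hbody hend).le (by simp)

/-! ### Straight-line code -/

/-- Absence of loops, random draws and writes to the real memory. -/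
def Cmd.Straight : Cmd → Prop
  | .skip | .setN .. | .ask .. | .submit => True
  | .seq p q | .ite _ p q => p.Straight ∧ q.Straight
  | _ => False

/-- The number of nodes of a straight-line command. -/
def Cmd.size : Cmd → ℕ
  | .seq p q | .ite _ p q => 1 + p.size + q.size
  | _ => 1

open Classical in
/-- The effect of a straight-line command, not counting time. -/
noncomputable def Cmd.exec (O : ℕ → ℕ → ℕ) : Cmd → State → State
  | .setN a i e, s => s.writeN a (i.eval s) (e.eval s)
  | .ask a i k j, s => s.enqueue ⟨a, i.eval s, k.eval s, j.eval s⟩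
  | .submit, s => s.send O
  | .seq p q, s => q.exec O (p.exec O s)
  | .ite b p q, s => if b.holds s then p.exec O s else q.exec O s
  | _, s => s

/-- Each node costs one step and only one branch of a conditional runs, so the time bound is a
syntactic count. Invariants are then needed for loops only. -/
theorem terminatesIn_straight (hp : p.Straight) (h : Q (p.exec O s)) :
    TerminatesIn O p s p.size Q := by
  induction p generalizing s Q with
  | skip => exact terminatesIn_skip h
  | setN => exact terminatesIn_setN h
  | ask => exact terminatesIn_ask h
  | submit => exact terminatesIn_submit h
  | seq p q ihp ihq => exact .seq (ihp hp.1 (ihq hp.2 h))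
  | ite b p q ihp ihq =>
    refine (TerminatesIn.ite (t := p.size + q.size) (fun hb => ?_) fun hb => ?_).le
      (by simp [Cmd.size]; omega)
    · rw [Cmd.exec, if_pos hb] at h
      exact (ihp hp.1 h).le (by omega)
    · rw [Cmd.exec, if_neg hb] at h
      exact (ihq hp.2 h).le (by omega)
  | setR => exact hp.elim
  | rand => exact hp.elim
  | loop => exact hp.elim

/-! ### From runs to expected costs -/

theorem tsum_bind_mul {α β : Type*} (m : PMF α) (κ : α → PMF β) (g : β → ℝ≥0∞) :
    ∑' b, m.bind κ b * g b = ∑' a, m a * ∑' b, κ a b * g b := by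
  simp_rw [PMF.bind_apply, ← ENNReal.tsum_mul_right, ← ENNReal.tsum_mul_left]
  rw [ENNReal.tsum_comm]
  simp_rw [mul_assoc]

theorem le_tsum_mul_of_support {β : Type*} (m : PMF β) (g : β → ℝ≥0∞) (v : ℝ≥0∞)
    (h : ∀ b ∈ m.support, v ≤ g b) : v ≤ ∑' b, m b * g b := by
  calc v = ∑' b, m b * v := by rw [ENNReal.tsum_mul_right, m.tsum_coe, one_mul]
    _ ≤ _ := by
      refine ENNReal.tsum_le_tsum fun b => ?_
      by_cases hb : m b = 0
      · simp [hb]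
      · gcongr; exact h b ((m.mem_support_iff b).2 hb)

theorem tsum_pure_mul {β : Type*} (b : β) (g : β → ℝ≥0∞) :
    ∑' c, PMF.pure b c * g c = g b := by
  classical
  rw [tsum_eq_single b]
  · simp
  · intro c hc; simp [PMF.pure_apply, hc]

/-- A counter that no step of the machine decreases. -/
def NeverDecreases (O : ℕ → ℕ → ℕ) (cost : State → ℕ) : Prop :=
  ∀ c, ∀ c' ∈ (step O c).support, cost c.state ≤ cost c'.state

theorem neverDecreases_of_le {cost : State → ℕ}
    (hw : ∀ (s : State) a i v, cost s ≤ cost (s.writeN a i v).tick)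
    (hr : ∀ (s : State) a i v, cost s ≤ cost (s.writeR a i v).tick)
    (hq : ∀ (s : State) q, cost s ≤ cost (s.enqueue q).tick)
    (hs : ∀ s : State, cost s ≤ cost (s.send O).tick)
    (ht : ∀ s : State, cost s ≤ cost s.tick) : NeverDecreases O cost := by
  rintro ⟨todo, s⟩ c' hc'
  rcases todo with _ | ⟨p, k⟩
  · simp only [step, PMF.support_pure, Set.mem_singleton_iff] at hc'
    subst hc'; exact le_rfl
  · cases p
    case rand a i e =>
      simp only [step, PMF.support_map] at hc'
      obtain ⟨v, -, rfl⟩ := hc'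
      exact hw _ _ _ _
    all_goals
      simp only [step, PMF.support_pure, Set.mem_singleton_iff] at hc'
      subst hc'
      first | exact hw _ _ _ _ | exact hr _ _ _ _ | exact hq _ _ | exact hs _ | exact ht _

theorem neverDecreases_time : NeverDecreases O State.time := by
  apply neverDecreases_of_le <;> intros <;> simp [State.tick, State.writeN, State.writeR,
    State.enqueue, send_eq]

theorem neverDecreases_queries : NeverDecreases O State.queries := by
  apply neverDecreases_of_le <;> intros <;> simp [State.tick, State.writeN, State.writeR,
    State.enqueue, send_eq]

theorem neverDecreases_rounds : NeverDecreases O State.rounds := by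
  apply neverDecreases_of_le <;> intros <;> simp [State.tick, State.writeN, State.writeR,
    State.enqueue, send_eq]

/-- Monotonicity in `T` allows the supremum in `expectedCost` to be bounded by looking only at times
after the program has halted. -/
theorem expectation_mono {cost : State → ℕ} (h : NeverDecreases O cost) (c : Config) :
    Monotone fun T => ∑' c', run O c T c' * (cost c'.state : ℝ≥0∞) := by
  refine monotone_nat_of_le_succ fun T => ?_
  simp only [run, tsum_bind_mul]
  refine ENNReal.tsum_le_tsum fun c' => ?_
  gcongr
  exact le_tsum_mul_of_support _ _ _ fun b hb => by exact_mod_cast h c' b hb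

variable {P : Cmd} {d n : ℕ} {α : ℝ} {x : Fin n → ℝ} {f : ℝ[X]}

theorem learn_of_terminatesIn
    (h : TerminatesIn (derivOracle d x f) P (init P d α x).state t Q) :
    ∃ s' t', t' ≤ t ∧ Q s' ∧ ∀ T, learn P d α x f (t' + T) = PMF.pure ⟨[], s'.atTime t'⟩ := by
  obtain ⟨s', t', ht, hQ, hr⟩ := h
  refine ⟨s', t', ht, hQ, fun T => ?_⟩
  have := hr [] 0
  rw [Nat.zero_add] at this
  rw [learn, ← run_halted (O := derivOracle d x f) (s'.atTime t') T]
  exact run_add_of_pure this T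

theorem expectedCost_le_of_terminatesIn {cost : State → ℕ}
    (hc : NeverDecreases (derivOracle d x f) cost) {B : ℕ}
    (h : TerminatesIn (derivOracle d x f) P (init P d α x).state t Q)
    (hB : ∀ s t', t' ≤ t → Q s → cost (s.atTime t') ≤ B) :
    expectedCost cost P d α x f ≤ B := by
  obtain ⟨s', t', ht, hQ, hr⟩ := learn_of_terminatesIn h
  -- At time `t' + T` the run is a point mass at the final configuration, so the expectation there
  -- is the final counter.
  refine iSup_le fun T => (expectation_mono hc _ (Nat.le_add_left T t')).trans ?_
  have := hr T
  rw [learn] at this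
  simp only [this, tsum_pure_mul]
  exact_mod_cast hB _ _ ht hQ

theorem expectedCost_time_le
    (h : TerminatesIn (derivOracle d x f) P (init P d α x).state t Q) :
    expectedCost State.time P d α x f ≤ t :=
  expectedCost_le_of_terminatesIn neverDecreases_time h fun _ _ ht _ => ht

theorem expectedCost_queries_le {B : ℕ}
    (h : TerminatesIn (derivOracle d x f) P (init P d α x).state t Q)
    (hB : ∀ s, Q s → s.queries ≤ B) :
    expectedCost State.queries P d α x f ≤ B :=
  expectedCost_le_of_terminatesIn neverDecreases_queries h fun s _ _ hs => hB s hs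

theorem expectedCost_rounds_le {B : ℕ}
    (h : TerminatesIn (derivOracle d x f) P (init P d α x).state t Q)
    (hB : ∀ s, Q s → s.rounds ≤ B) :
    expectedCost State.rounds P d α x f ≤ B :=
  expectedCost_le_of_terminatesIn neverDecreases_rounds h fun s _ _ hs => hB s hs

theorem labelsPerfectly_of_terminatesIn
    (h : TerminatesIn (derivOracle d x f) P (init P d α x).state t Q)
    (hQ : ∀ s, Q s → ∀ j : Fin n, s.nat 1 j = signBit (f.eval (x j))) :
    LabelsPerfectly P d α x f := by
  obtain ⟨s', t', ht, hs, hr⟩ := learn_of_terminatesIn h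
  refine le_antisymm (iSup_le fun T => ?_) (le_iSup_of_le (t' + 0) ?_)
  · refine (MeasureTheory.measure_mono (Set.subset_univ _)).trans ?_
    rw [(PMF.toOuterMeasure_apply_eq_one_iff _ _).2 (Set.subset_univ _)]
  · rw [(PMF.toOuterMeasure_apply_eq_one_iff _ _).2]
    rw [hr, PMF.support_pure, Set.singleton_subset_iff]
    exact ⟨rfl, hQ s' hs⟩

end Semantics

/-! ### The program

Natural arrays: `0` input sizes, `1` labels, `2` and `3` answers at the left and right end points
of the intervals, `4` the sample indices in increasing order of the points, `5` scratch space for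
sorting, `6` powers of two, `7` marks of the positions whose label is known; the arrays from `10`
on are used as scalar variables. -/

section Program

local infixr:60 " ⨾ " => Cmd.seq

/-- A scalar variable. -/
abbrev NExp.var (a : ℕ) : NExp := .cell a (.lit 0)

/-- Assignment to a scalar variable. -/
abbrev Cmd.assign (a : ℕ) (e : NExp) : Cmd := .setN a (.lit 0) e

/-- The test `e < e'`. -/
abbrev BExp.lt (e e' : NExp) : BExp := .neg (.leN e' e)

/-- The sample size. -/
abbrev NExp.size : NExp := .cell 0 (.lit 0)

/-- The degree bound. -/
abbrev NExp.deg : NExp := .cell 0 (.lit 1)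

/-- Increment of a scalar variable. -/
abbrev Cmd.incr (a : ℕ) : Cmd := .assign a (.plus (.var a) (.lit 1))

/-- Tabulate the powers of two up to the first one that is at least the sample size. -/
def powers : Cmd :=
  .setN 6 (.lit 0) (.lit 1) ⨾
  .loop (.lt (.cell 6 (.var 10)) .size)
    (.setN 6 (.plus (.var 10) (.lit 1)) (.plus (.cell 6 (.var 10)) (.cell 6 (.var 10))) ⨾
      .incr 10)

/-- Compute the logarithm of the branching factor. -/
def exponent : Cmd :=
  .loop (.neg (.leR (.times (.cell 1 (.lit 0)) (.ofN (.var 10))) (.ofN (.var 11)))) (.incr 11)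

/-- Query all labels in one batch. -/
def queryAll : Cmd :=
  .loop (.lt (.var 18) .size) (.ask 1 (.var 18) (.lit 0) (.var 18) ⨾ .incr 18) ⨾ .submit

/-- Initialize the ordering and test whether the sample is increasing. -/
def identity : Cmd :=
  .loop (.lt (.var 18) .size)
    (.setN 4 (.var 18) (.var 18) ⨾
      .ite (.conj (.lt (.plus (.var 18) (.lit 1)) .size)
          (.neg (.leR (.cell 0 (.var 18)) (.cell 0 (.plus (.var 18) (.lit 1))))))
        (.assign 19 (.lit 1)) .skip ⨾
      .incr 18)

/-- One step of merging two adjacent sorted blocks. -/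
def mergeStep : Cmd :=
  .ite (.conj (.lt (.var 23) (.var 21))
      (.neg (.conj (.lt (.var 24) (.var 22))
        (.neg (.leR (.cell 0 (.cell 4 (.var 23))) (.cell 0 (.cell 4 (.var 24))))))))
    (.setN 5 (.var 25) (.cell 4 (.var 23)) ⨾ .incr 23)
    (.setN 5 (.var 25) (.cell 4 (.var 24)) ⨾ .incr 24) ⨾
  .incr 25

/-- The smaller of an expression and the sample size. -/
abbrev NExp.cap (e : NExp) : NExp := .minus e (.minus e .size)

/-- Merge the two blocks of width `13` that start at `20`. -/
def mergeBlock : Cmd :=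
  (.assign 21 (.cap (.plus (.var 20) (.var 13))) ⨾
  .assign 22 (.cap (.plus (.var 20) (.plus (.var 13) (.var 13)))) ⨾
  .assign 23 (.var 20) ⨾ .assign 24 (.var 21) ⨾ .assign 25 (.var 20)) ⨾
  .loop (.lt (.var 25) (.var 22)) mergeStep ⨾
  .assign 20 (.plus (.var 20) (.plus (.var 13) (.var 13)))

/-- Double the width of the sorted blocks. -/
def mergePass : Cmd :=
  (.assign 13 (.cell 6 (.var 26)) ⨾ .assign 20 (.lit 0)) ⨾
  .loop (.lt (.var 20) .size) mergeBlock ⨾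
  .assign 18 (.lit 0) ⨾
  .loop (.lt (.var 18) .size) (.setN 4 (.var 18) (.cell 5 (.var 18)) ⨾ .incr 18) ⨾
  .incr 26

/-- Bottom-up merge sort. -/
def mergeSort : Cmd := .loop (.lt (.var 26) (.var 10)) mergePass

/-- Query all derivatives at both ends of an interval. -/
def askInterval : Cmd :=
  .assign 16 (.lit 0) ⨾
  .loop (.lt (.var 16) .deg)
    (.ask 2 (.plus (.var 15) (.var 16)) (.var 16) (.cell 4 (.var 14)) ⨾
      .ask 3 (.plus (.var 15) (.var 16)) (.var 16) (.cell 4 (.plus (.var 14) (.var 13))) ⨾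
      .incr 16)

/-- Go to the next interval. -/
def advance : Cmd :=
  .assign 14 (.plus (.var 14) (.var 13)) ⨾ .assign 15 (.plus (.var 15) .deg)

/-- Execute `p` for all intervals of width `13` that are not resolved. -/
def forIntervals (p : Cmd) : Cmd :=
  (.assign 14 (.lit 0) ⨾ .assign 15 (.lit 0)) ⨾
  .loop (.lt (.var 14) .size) (.ite (.leN (.cell 7 (.var 14)) (.lit 0)) p .skip ⨾ advance)

/-- Mark and label all positions of an interval. -/
def labelInterval : Cmd :=
  .assign 18 (.var 14) ⨾
  .loop (.lt (.var 18) (.plus (.var 14) (.var 13)))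
    (.setN 7 (.var 18) (.lit 1) ⨾ .setN 1 (.cell 4 (.var 18)) (.cell 2 (.var 15)) ⨾ .incr 18)

/-- Compare the answers at both ends of an interval. -/
def compareEnds : Cmd :=
  (.assign 16 (.lit 0) ⨾ .assign 17 (.lit 0)) ⨾
  .loop (.lt (.var 16) .deg)
    (.ite (.conj
        (.leN (.cell 2 (.plus (.var 15) (.var 16))) (.cell 3 (.plus (.var 15) (.var 16))))
        (.leN (.cell 3 (.plus (.var 15) (.var 16))) (.cell 2 (.plus (.var 15) (.var 16)))))
      .skip (.assign 17 (.lit 1)) ⨾ .incr 16)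

/-- Label an interval if it consists of one point or the answers at both ends agree. -/
def resolveInterval : Cmd :=
  compareEnds ⨾
  .ite (.neg (.conj (.neg (.leN (.var 13) (.lit 1)))
      (.neg (.conj (.leN (.var 17) (.lit 0)) (.lt (.plus (.var 14) (.var 13)) .size)))))
    labelInterval .skip

/-- One round: refine the grid and treat all unresolved intervals. -/
def refine : Cmd :=
  (.assign 12 (.minus (.var 12) (.var 11)) ⨾ .assign 13 (.cell 6 (.var 12))) ⨾
  forIntervals askInterval ⨾ .submit ⨾ forIntervals resolveInterval

/-- Refine the grid until all labels are known. -/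
def search : Cmd := .assign 12 (.var 10) ⨾ .loop (.lt (.lit 0) (.var 12)) refine

/-- The learner. -/
def learner : Cmd :=
  powers ⨾ exponent ⨾
  .ite (.leR (.times (.times (.times (.ofN .deg) (.ofN .deg)) (.ofN .deg))
      (.ofN (.cell 6 (.var 11)))) (.ofN .size))
    (identity ⨾ .ite (.leN (.lit 1) (.var 19)) mergeSort .skip ⨾ search)
    queryAll

end Program

/-! ### Symbolic execution -/

section Symbolic

variable {O : ℕ → ℕ → ℕ} {s s₀ s₁ s₂ : State} {A B : List ℕ}

theorem writeN_nat (s : State) (a i v b j : ℕ) :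
    (s.writeN a i v).nat b j = if b = a ∧ j = i then v else s.nat b j := by
  by_cases hb : b = a
  · subst hb
    by_cases hj : j = i
    · subst hj; simp [State.writeN]
    · simp [State.writeN, hj]
  · simp [State.writeN, hb]

theorem writeN_row (s : State) {a i v b : ℕ} (h : b ≠ a) :
    (s.writeN a i v).nat b = s.nat b := by
  simp [State.writeN, h]

@[simp] theorem writeN_real (s : State) (a i v : ℕ) : (s.writeN a i v).real = s.real := rfl
@[simp] theorem writeN_batch (s : State) (a i v : ℕ) : (s.writeN a i v).batch = s.batch := rfl
@[simp] theorem writeN_queries (s : State) (a i v : ℕ) :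
    (s.writeN a i v).queries = s.queries := rfl
@[simp] theorem writeN_rounds (s : State) (a i v : ℕ) :
    (s.writeN a i v).rounds = s.rounds := rfl
@[simp] theorem enqueue_nat (s : State) (q : Pending) : (s.enqueue q).nat = s.nat := rfl
@[simp] theorem enqueue_batch (s : State) (q : Pending) :
    (s.enqueue q).batch = s.batch ++ [q] := rfl

attribute [simp] NExp.eval RExp.eval BExp.holds Cmd.exec Cmd.Straight Cmd.size writeN_nat

/-- The state `s` differs from `s₀` in the arrays listed in `A` and in the batch only. -/
structure Agrees (A : List ℕ) (s₀ s : State) : Prop where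
  nat : ∀ a ∉ A, s.nat a = s₀.nat a
  real : s.real = s₀.real
  queries : s.queries = s₀.queries
  rounds : s.rounds = s₀.rounds

theorem Agrees.refl (A : List ℕ) (s : State) : Agrees A s s :=
  ⟨fun _ _ => rfl, rfl, rfl, rfl⟩

theorem Agrees.trans (h : Agrees A s₀ s₁) (h' : Agrees B s₁ s₂) (hA : A ⊆ B) :
    Agrees B s₀ s₂ :=
  ⟨fun a ha => (h'.nat a ha).trans (h.nat a fun h => ha (hA h)), h'.real.trans h.real,
    h'.queries.trans h.queries, h'.rounds.trans h.rounds⟩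

theorem Agrees.writeN (h : Agrees A s₀ s) {a i v : ℕ} (ha : a ∈ A) :
    Agrees A s₀ (s.writeN a i v) :=
  ⟨fun b hb => by rw [writeN_row s (by rintro rfl; exact hb ha), h.nat b hb],
    h.real, h.queries, h.rounds⟩

theorem Agrees.enqueue (h : Agrees A s₀ s) {q : Pending} : Agrees A s₀ (s.enqueue q) :=
  ⟨h.nat, h.real, h.queries, h.rounds⟩

theorem powers_spec (h10 : s₀.nat 10 0 = 0) :
    TerminatesIn O powers s₀ (4 * Nat.clog 2 (s₀.nat 0 0) + 3) fun s =>
      Agrees [6, 10] s₀ s ∧ s.batch = s₀.batch ∧ s.nat 10 0 = Nat.clog 2 (s₀.nat 0 0) ∧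
        ∀ p ≤ Nat.clog 2 (s₀.nat 0 0), s.nat 6 p = 2 ^ p := by
  refine (TerminatesIn.seq (terminatesIn_straight (by simp)
    (TerminatesIn.loop_const (fun i s => Agrees [6, 10] s₀ s ∧ s.batch = s₀.batch ∧
      s.nat 10 0 = i ∧ ∀ p ≤ i, s.nat 6 p = 2 ^ p) (Nat.clog 2 (s₀.nat 0 0)) 3
      ?_ ?_ ?_ ?_))).le ?_
  · exact ⟨(Agrees.refl _ _).writeN (by simp), by simp, by simpa, by simp⟩
  · rintro i hi s ⟨hA, hb, h, hp⟩
    have h0 : s.nat 0 0 = s₀.nat 0 0 := by rw [hA.nat 0 (by simp)]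
    have := hp i le_rfl
    have := (Nat.lt_clog_iff_pow_lt (by norm_num)).1 hi
    simp_all
  · rintro i hi s ⟨hA, hb, h, hp⟩
    refine terminatesIn_straight (by simp) ⟨?_, ?_, ?_, ?_⟩
    · exact (hA.writeN (by simp)).writeN (by simp)
    · simpa
    · simpa
    · intro p hp'
      rcases Nat.lt_or_ge p (i + 1) with h1 | h1
      · have h2 : p ≠ i + 1 := by omega
        simp [h, h2, hp p (by omega)]
      · obtain rfl : p = i + 1 := by omega
        simp [h, hp i le_rfl, pow_succ]; omega
  · rintro s ⟨hA, hb, h, hp⟩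
    have h0 : s.nat 0 0 = s₀.nat 0 0 := by rw [hA.nat 0 (by simp)]
    have h1 := hp _ le_rfl
    have := Nat.le_pow_clog (b := 2) (by norm_num) (s₀.nat 0 0)
    simp only [BExp.holds, NExp.eval, h, h1, h0]
    omega
  · simp; omega

/-- Reals cannot be rounded by the machine, so the ceiling is reached by counting up until the
product no longer exceeds the counter. -/
theorem exponent_spec (h11 : s₀.nat 11 0 = 0) :
    TerminatesIn O exponent s₀ (2 * ⌈s₀.real 1 0 * s₀.nat 10 0⌉₊ + 1) fun s =>
      Agrees [11] s₀ s ∧ s.batch = s₀.batch ∧ s.nat 11 0 = ⌈s₀.real 1 0 * s₀.nat 10 0⌉₊ := by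
  refine (TerminatesIn.loop_const (fun i s => Agrees [11] s₀ s ∧ s.batch = s₀.batch ∧
    s.nat 11 0 = i) _ 1 ?_ ?_ ?_ ?_).le ?_
  · exact ⟨.refl _ _, rfl, h11⟩
  · rintro i hi s ⟨hA, hb, h⟩
    have h0 : s.nat 10 0 = s₀.nat 10 0 := by rw [hA.nat 10 (by simp)]
    rw [Nat.lt_ceil] at hi
    simpa [h0, hA.real, h]
  · rintro i hi s ⟨hA, hb, h⟩
    exact terminatesIn_straight (by simp) ⟨hA.writeN (by simp), by simpa, by simpa⟩
  · rintro s ⟨hA, hb, h⟩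
    have h0 : s.nat 10 0 = s₀.nat 10 0 := by rw [hA.nat 10 (by simp)]
    simpa [h0, hA.real, h] using Nat.le_ceil _
  · omega

/-- No answer is in memory before `submit`, so the loop invariant describes what the pending batch
will write. -/
theorem queryAll_spec (h18 : s₀.nat 18 0 = 0) (hb : s₀.batch = []) :
    TerminatesIn O queryAll s₀ (4 * s₀.nat 0 0 + 3) fun s =>
      (∀ j < s₀.nat 0 0, s.nat 1 j = O 0 j) ∧ s.queries = s₀.queries + s₀.nat 0 0 ∧
        s.rounds = s₀.rounds + 1 := by
  refine (TerminatesIn.andThen (u := 1) (TerminatesIn.loop_const (fun i s => Agrees [18] s₀ s ∧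
    s.batch.length = i ∧ (∀ j < i, answerRow O 1 s.batch (s.nat 1) j = O 0 j) ∧
    s.nat 18 0 = i) (s₀.nat 0 0) 3 ?_ ?_ ?_ ?_) fun s h => ?_).le ?_
  · exact ⟨.refl _ _, by simp [hb], by simp, h18⟩
  · rintro i hi s ⟨hA, -, -, h⟩
    have h0 : s.nat 0 0 = s₀.nat 0 0 := by rw [hA.nat 0 (by simp)]
    simpa [h0, h]
  · rintro i hi s ⟨hA, hb, ha, h⟩
    refine terminatesIn_straight (by simp) ⟨hA.enqueue.writeN (by simp), by simpa, ?_, by simpa⟩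
    intro j hj
    simp only [Cmd.exec, writeN_batch, enqueue_batch, NExp.eval, answerRow_append, h]
    rw [writeN_row _ (by simp)]
    rcases Nat.lt_or_ge j i with h1 | h1
    · simp [answerRow, Function.update_of_ne h1.ne]
      exact ha j h1
    · obtain rfl : j = i := by omega
      simp [answerRow]
  · rintro s ⟨hA, -, -, h⟩
    have h0 : s.nat 0 0 = s₀.nat 0 0 := by rw [hA.nat 0 (by simp)]
    simp [h0, h]
  · obtain ⟨hA, hb, ha, h⟩ := h
    refine terminatesIn_submit ?_
    simp only [send_eq]
    exact ⟨ha, by rw [hb, hA.queries], by rw [hA.rounds]⟩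
  · omega

theorem identity_spec (h18 : s₀.nat 18 0 = 0) (h19 : s₀.nat 19 0 = 0) :
    TerminatesIn O identity s₀ (8 * s₀.nat 0 0 + 1) fun s =>
      Agrees [4, 18, 19] s₀ s ∧ s.batch = s₀.batch ∧ (∀ i < s₀.nat 0 0, s.nat 4 i = i) ∧
        (s.nat 19 0 = 0 ↔ ∀ i, i + 1 < s₀.nat 0 0 → s₀.real 0 i ≤ s₀.real 0 (i + 1)) := by
  refine (TerminatesIn.loop_const (fun i s => Agrees [4, 18, 19] s₀ s ∧
    s.batch = s₀.batch ∧ s.nat 18 0 = i ∧ (∀ j < i, s.nat 4 j = j) ∧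
    (s.nat 19 0 = 0 ↔ ∀ j < i, j + 1 < s₀.nat 0 0 → s₀.real 0 j ≤ s₀.real 0 (j + 1)))
    (s₀.nat 0 0) 7 ?_ ?_ ?_ ?_).mono (by omega) ?_
  · exact ⟨.refl _ _, rfl, h18, by simp, by simpa⟩
  · rintro i hi s ⟨hA, -, h, -⟩
    have h0 : s.nat 0 0 = s₀.nat 0 0 := by rw [hA.nat 0 (by simp)]
    simpa [h0, h]
  · rintro i hi s ⟨hA, hb, h, h4, hs⟩
    have h0 : s.nat 0 0 = s₀.nat 0 0 := by rw [hA.nat 0 (by simp)]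
    refine (terminatesIn_straight (by simp) ?_).le (by simp)
    simp only [Cmd.exec, BExp.holds, NExp.eval, RExp.eval, writeN_real, hA.real]
    have h4' : ∀ j < i + 1, (if j = i then i else s.nat 4 j) = j := by
      intro j hj
      split_ifs with h'
      · exact h'.symm
      · exact h4 j (by omega)
    split_ifs with hc
    · refine ⟨((hA.writeN (by simp)).writeN (by simp)).writeN (by simp), by simpa, by simp [h],
        by simpa [h] using h4', ?_⟩
      simp [h, h0] at hc
      simp only [writeN_nat]
      simp only [Nat.reduceEqDiff, false_and, and_self, if_true, if_false, one_ne_zero, false_iff]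
      intro hall
      exact absurd (hall i (by omega) hc.1) (by simpa using hc.2)
    · refine ⟨(hA.writeN (by simp)).writeN (by simp), by simpa, by simp [h],
        by simpa [h] using h4', ?_⟩
      simp [h, h0] at hc
      simp only [writeN_nat]
      simp only [Nat.reduceEqDiff, false_and, if_false, hs]
      refine ⟨fun H j hj hj' => ?_, fun H j hj => H j (by omega)⟩
      rcases Nat.lt_or_ge j i with h1 | h1
      · exact H j h1 hj'
      · obtain rfl : j = i := by omega
        exact hc hj'
  · rintro s ⟨hA, -, h, -⟩
    have h0 : s.nat 0 0 = s₀.nat 0 0 := by rw [hA.nat 0 (by simp)]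
    simp [h0, h]
  · rintro s ⟨hA, hb, -, h4, hs⟩
    exact ⟨hA, hb, h4, hs.trans ⟨fun H i hi => H i (by omega) hi, fun H i _ hi => H i hi⟩⟩

end Symbolic

/-! ### Merge sort -/

section Sorting

variable {O : ℕ → ℕ → ℕ} {s s₀ : State} {X : ℕ → ℝ} {σ τ τ' : ℕ → ℕ} {S R R' : Set ℕ}

theorem lt_ceilDiv_iff {W n i : ℕ} (hW : 0 < W) : i < n ⌈/⌉ W ↔ i * W < n := by
  rw [← not_le, ceilDiv_le_iff_le_mul hW, not_le, mul_comm]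

theorem le_ceilDiv_mul {W : ℕ} (n : ℕ) (hW : 0 < W) : n ≤ (n ⌈/⌉ W) * W := by
  by_contra! h
  exact lt_irrefl _ ((lt_ceilDiv_iff hW).2 h)

theorem ceilDiv_mul_le {W : ℕ} (n : ℕ) (hW : 0 < W) : (n ⌈/⌉ W) * W ≤ n + W := by
  rcases Nat.eq_zero_or_pos (n ⌈/⌉ W) with h | h
  · simp [h]
  · obtain ⟨k, hk⟩ := Nat.exists_eq_add_of_lt h
    have := (lt_ceilDiv_iff (i := k) (n := n) hW).1 (by omega)
    rw [hk, zero_add, add_mul]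
    omega

/-- The entries of `τ` from `lo` to `t` list the entries of `σ` at the positions in `S` outside
`R` in increasing order, and they are at most the entries at the positions in `R`. -/
structure Merging (X : ℕ → ℝ) (σ : ℕ → ℕ) (S : Set ℕ) (lo t : ℕ) (τ : ℕ → ℕ) (R : Set ℕ) :
    Prop where
  source : ∀ u, lo ≤ u → u < t → ∃ p ∈ S, τ u = σ p
  consumed : ∀ p ∈ S, p ∉ R → ∃ u, lo ≤ u ∧ u < t ∧ τ u = σ p
  sorted : ∀ u v, lo ≤ u → u ≤ v → v < t → X (τ u) ≤ X (τ v)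
  remaining : ∀ u, lo ≤ u → u < t → ∀ p ∈ R, X (τ u) ≤ X (σ p)

/-- Appending a minimum of the remaining entries preserves everything: it is at least the entries
already listed by `remaining`, and at most those still left by `hmin`. The block it came from plays
no role. -/
theorem Merging.step {lo t p₀ : ℕ} (h : Merging X σ S lo t τ R) (hτ : ∀ u < t, τ' u = τ u)
    (ht : τ' t = σ p₀) (h₀ : p₀ ∈ S) (h₀' : p₀ ∈ R) (hmin : ∀ p ∈ R, X (σ p₀) ≤ X (σ p))
    (hlo : lo ≤ t) (hR : R' ⊆ R) (hR' : ∀ p ∈ R, p ≠ p₀ → p ∈ R') :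
    Merging X σ S lo (t + 1) τ' R' where
  source u hu hut := by
    rcases Nat.lt_or_ge u t with h1 | h1
    · rw [hτ u h1]; exact h.source u hu h1
    · obtain rfl : u = t := by omega
      exact ⟨p₀, h₀, ht⟩
  consumed p hp hpR := by
    by_cases hp₀ : p = p₀
    · exact ⟨t, hlo, by omega, hp₀ ▸ ht⟩
    · obtain ⟨u, hu, hut, e⟩ := h.consumed p hp fun h' => hpR (hR' p h' hp₀)
      exact ⟨u, hu, by omega, (hτ u hut).trans e⟩
  sorted u v hu huv hv := by
    rcases Nat.lt_or_ge v t with h1 | h1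
    · rw [hτ u (by omega), hτ v h1]; exact h.sorted u v hu huv h1
    · obtain rfl : v = t := by omega
      rcases huv.lt_or_eq with h2 | rfl
      · rw [hτ u h2, ht]; exact h.remaining u hu h2 p₀ h₀'
      · exact le_rfl
  remaining u hu hut p hp := by
    rcases Nat.lt_or_ge u t with h1 | h1
    · rw [hτ u h1]; exact h.remaining u hu h1 p (hR hp)
    · obtain rfl : u = t := by omega
      rw [ht]; exact hmin p (hR hp)

/-- The positions that are left in two adjacent blocks. -/
def leftover (i mid j hi : ℕ) : Set ℕ := {p | (i ≤ p ∧ p < mid) ∨ (j ≤ p ∧ p < hi)}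

/-- Each block of `W` consecutive entries of `τ` below `n` is sorted. -/
def SortedBlocks (X : ℕ → ℝ) (τ : ℕ → ℕ) (W n : ℕ) : Prop :=
  ∀ p q, p ≤ q → q < n → p / W = q / W → X (τ p) ≤ X (τ q)

/-- Both blocks are sorted, so the smaller of the two heads `i` and `j` is a minimum of the
leftover, and `Merging.step` applies. The equation `i + j = lo + mid + m` counts the entries already
moved. -/
theorem mergeLoop_spec {lo mid hi : ℕ} (h20 : s₀.nat 21 0 = mid) (h22 : s₀.nat 22 0 = hi)
    (h23 : s₀.nat 23 0 = lo) (h24 : s₀.nat 24 0 = mid) (h25 : s₀.nat 25 0 = lo)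
    (hX : s₀.real 0 = X) (hσ : s₀.nat 4 = σ) (hlm : lo ≤ mid) (hmh : mid ≤ hi)
    (hs₁ : ∀ p q, lo ≤ p → p ≤ q → q < mid → X (σ p) ≤ X (σ q))
    (hs₂ : ∀ p q, mid ≤ p → p ≤ q → q < hi → X (σ p) ≤ X (σ q)) :
    TerminatesIn O (.loop (.lt (.var 25) (.var 22)) mergeStep) s₀ (10 * (hi - lo) + 1) fun s =>
      Agrees [5, 23, 24, 25] s₀ s ∧ s.batch = s₀.batch ∧ (∀ t < lo, s.nat 5 t = s₀.nat 5 t) ∧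
        Merging X σ (leftover lo mid mid hi) lo hi (s.nat 5) ∅ := by
  refine (TerminatesIn.loop_const (fun m s => Agrees [5, 23, 24, 25] s₀ s ∧
    s.batch = s₀.batch ∧ (∀ t < lo, s.nat 5 t = s₀.nat 5 t) ∧ s.nat 25 0 = lo + m ∧
    ∃ i j, s.nat 23 0 = i ∧ s.nat 24 0 = j ∧ lo ≤ i ∧ i ≤ mid ∧ mid ≤ j ∧ j ≤ hi ∧
      i + j = lo + mid + m ∧
      Merging X σ (leftover lo mid mid hi) lo (lo + m) (s.nat 5) (leftover i mid j hi))
    (hi - lo) 9 ?_ ?_ ?_ ?_).mono (by omega) ?_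
  · refine ⟨.refl _ _, rfl, fun _ _ => rfl, h25, lo, mid, h23, h24, le_rfl, hlm, le_rfl, hmh,
      rfl, ?_⟩
    exact ⟨fun u _ _ => by omega, fun p h h' => absurd h h', fun u v _ _ _ => by omega,
      fun u _ _ => by omega⟩
  · rintro m hm s ⟨hA, -, -, h, -⟩
    have h22' : s.nat 22 0 = hi := by rw [hA.nat 22 (by simp), h22]
    simp [h, h22']; omega
  · rintro m hm s ⟨hA, hb, hlo, h, i, j, hi', hj', hli, him, hmj, hjh, hij, hM⟩
    have h22' : s.nat 22 0 = hi := by rw [hA.nat 22 (by simp), h22]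
    have h21' : s.nat 21 0 = mid := by rw [hA.nat 21 (by simp), h20]
    have h4' : s.nat 4 = σ := by rw [hA.nat 4 (by simp), hσ]
    have hX' : s.real 0 = X := by rw [hA.real, hX]
    refine (terminatesIn_straight (by simp [mergeStep]) ?_).le (by simp [mergeStep])
    simp only [mergeStep, Cmd.exec, BExp.holds, NExp.eval, RExp.eval, h22', h21', hi', hj', h4',
      hX']
    split_ifs with hc
    · refine ⟨((hA.writeN (by simp)).writeN (by simp)).writeN (by simp), by simpa, ?_,
        by simp [h, add_assoc], i + 1, j, by simp [hi'], by simp [hj'], by omega, by omega, hmj,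
        hjh, by omega, ?_⟩
      · intro t ht
        have : t ≠ s.nat 25 0 := by omega
        simpa [this] using hlo t ht
      · rw [← Nat.add_assoc]
        refine hM.step (p₀ := i) (fun u hu => ?_) ?_ (Or.inl ⟨hli, by omega⟩)
          (Or.inl ⟨le_rfl, by omega⟩) ?_ (by omega) ?_ ?_
        · have : u ≠ s.nat 25 0 := by omega
          simp [this]
        · simp [h, hi']
        · rintro p (⟨h1, h2⟩ | ⟨h1, h2⟩)
          · exact hs₁ _ _ hli h1 h2
          · have h3 : X (σ i) ≤ X (σ j) := by
              by_contra h3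
              exact hc.2 ⟨by omega, h3⟩
            exact h3.trans (hs₂ _ _ hmj h1 h2)
        · rintro p (⟨h1, h2⟩ | h1)
          exacts [Or.inl ⟨by omega, h2⟩, Or.inr h1]
        · rintro p (⟨h1, h2⟩ | h1) h3
          exacts [Or.inl ⟨by omega, h2⟩, Or.inr h1]
    -- If the right block were exhausted, the count `hij` would leave an entry in the left block and
    -- the test would have succeeded.
    · have hj : j < hi := by omega
      refine ⟨((hA.writeN (by simp)).writeN (by simp)).writeN (by simp), by simpa, ?_,
        by simp [h, add_assoc], i, j + 1, by simp [hi'], by simp [hj'], by omega, by omega,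
        by omega, by omega, by omega, ?_⟩
      · intro t ht
        have : t ≠ s.nat 25 0 := by omega
        simpa [this] using hlo t ht
      · rw [← Nat.add_assoc]
        refine hM.step (p₀ := j) (fun u hu => ?_) ?_ (Or.inr ⟨hmj, by omega⟩)
          (Or.inr ⟨le_rfl, by omega⟩) ?_ (by omega) ?_ ?_
        · have : u ≠ s.nat 25 0 := by omega
          simp [this]
        · simp [h, hj']
        · rintro p (⟨h1, h2⟩ | ⟨h1, h2⟩)
          · have h3 : X (σ j) ≤ X (σ i) := by
              by_contra h3
              exact hc ⟨by omega, fun h4 => h4.2 (le_of_not_ge h3)⟩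
            exact h3.trans (hs₁ _ _ hli h1 h2)
          · exact hs₂ _ _ hmj h1 h2
        · rintro p (h1 | ⟨h1, h2⟩)
          exacts [Or.inl h1, Or.inr ⟨by omega, h2⟩]
        · rintro p (h1 | ⟨h1, h2⟩) h3
          exacts [Or.inl h1, Or.inr ⟨by omega, h2⟩]
  · rintro s ⟨hA, -, -, h, -⟩
    have h22' : s.nat 22 0 = hi := by rw [hA.nat 22 (by simp), h22]
    simp [h, h22']; omega
  · rintro s ⟨hA, hb, hlo, h, i, j, hi', hj', hli, him, hmj, hjh, hij, hM⟩
    refine ⟨hA, hb, hlo, ?_⟩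
    have h1 : leftover i mid j hi = ∅ := by
      ext p; simp [leftover]; omega
    rwa [h1, show lo + (hi - lo) = hi by omega] at hM

theorem mergeBlock_spec {n w lo : ℕ} (hn : s₀.nat 0 0 = n) (hw : s₀.nat 13 0 = w)
    (h20 : s₀.nat 20 0 = lo) (hX : s₀.real 0 = X) (hσ : s₀.nat 4 = σ) (hlo : lo < n)
    (hs₁ : ∀ p q, lo ≤ p → p ≤ q → q < min (lo + w) n → X (σ p) ≤ X (σ q))
    (hs₂ : ∀ p q, lo + w ≤ p → p ≤ q → q < min (lo + (w + w)) n → X (σ p) ≤ X (σ q)) :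
    TerminatesIn O mergeBlock s₀ (20 * w + 13) fun s =>
      Agrees [5, 20, 21, 22, 23, 24, 25] s₀ s ∧ s.batch = s₀.batch ∧
        s.nat 20 0 = lo + (w + w) ∧ (∀ t < lo, s.nat 5 t = s₀.nat 5 t) ∧
        Merging X σ {p | lo ≤ p ∧ p < min (lo + (w + w)) n} lo (min (lo + (w + w)) n)
          (s.nat 5) ∅ := by
  -- `NExp.cap` obtains a minimum from truncated subtraction; it cuts off blocks that overhang the
  -- sample.
  have hmin (m : ℕ) : m - (m - n) = min m n := by omega
  set s₁ := Cmd.exec O (.seq (.assign 21 (.cap (.plus (.var 20) (.var 13))))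
    (.seq (.assign 22 (.cap (.plus (.var 20) (.plus (.var 13) (.var 13)))))
    (.seq (.assign 23 (.var 20)) (.seq (.assign 24 (.var 21)) (.assign 25 (.var 20)))))) s₀
    with hs₁'
  have hA₁ : Agrees [5, 20, 21, 22, 23, 24, 25] s₀ s₁ :=
    (((((Agrees.refl _ _).writeN (by simp)).writeN (by simp)).writeN (by simp)).writeN
      (by simp)).writeN (by simp)
  have e21 : s₁.nat 21 0 = min (lo + w) n := by simp [hs₁', h20, hw, hn, hmin]
  have e22 : s₁.nat 22 0 = min (lo + (w + w)) n := by simp [hs₁', h20, hw, hn, hmin]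
  have e23 : s₁.nat 23 0 = lo := by simp [hs₁', h20]
  have e24 : s₁.nat 24 0 = min (lo + w) n := by simp [hs₁', h20, hw, hn, hmin]
  have e25 : s₁.nat 25 0 = lo := by simp [hs₁', h20]
  have eX : s₁.real 0 = X := by simp [hs₁', hX]
  have e4 : s₁.nat 4 = σ := by rw [hA₁.nat 4 (by simp), hσ]
  have e5 : s₁.nat 5 = s₀.nat 5 := by funext t; simp [hs₁']
  refine (TerminatesIn.seq (t := 9) (u := 20 * w + 3) (terminatesIn_straight (by simp) ?_)).le
    (by omega)
  refine ((mergeLoop_spec e21 e22 e23 e24 e25 eX e4 (by omega) (by omega) hs₁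
    (fun p q h1 h2 h3 => hs₂ p q (by omega) h2 h3)).andThen (u := 1) fun s h => ?_).le
      (by omega)
  obtain ⟨hA, hb, h5, hM⟩ := h
  have hA' : Agrees [5, 20, 21, 22, 23, 24, 25] s₀ s := hA₁.trans ⟨fun a ha => hA.nat a (by
    simp at ha ⊢; tauto), hA.real, hA.queries, hA.rounds⟩ (by simp)
  refine terminatesIn_straight (by simp) ⟨hA'.writeN (by simp), by simpa [hs₁'] using hb, ?_, ?_,
    ?_⟩
  · have h20' : s.nat 20 0 = lo := by
      rw [hA.nat 20 (by simp)]; simp [hs₁', h20]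
    have hw' : s.nat 13 0 = w := by rw [hA'.nat 13 (by simp), hw]
    simp [h20', hw']
  · intro t ht
    simpa [e5] using h5 t ht
  · have h1 : leftover lo (min (lo + w) n) (min (lo + w) n) (min (lo + (w + w)) n) =
        {p | lo ≤ p ∧ p < min (lo + (w + w)) n} := by
      ext p; simp only [leftover, Set.mem_ofPred_eq]; omega
    simp only [Cmd.exec]
    rw [writeN_row _ (by simp), ← h1]
    exact hM

/-- Below `n`, the sequence `τ` takes exactly the values below `n`. -/
def Lists (τ : ℕ → ℕ) (n : ℕ) : Prop := (∀ i < n, τ i < n) ∧ ∀ v < n, ∃ i < n, τ i = v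

theorem mergePass_spec {n w p : ℕ} (hn : s₀.nat 0 0 = n) (h26 : s₀.nat 26 0 = p)
    (hw : s₀.nat 6 p = w) (hw0 : 0 < w) (hwn : w < n) (hX : s₀.real 0 = X)
    (hl : Lists (s₀.nat 4) n) (hs : SortedBlocks X (s₀.nat 4) w n) :
    TerminatesIn O mergePass s₀ (70 * n) fun s =>
      Agrees [4, 5, 13, 18, 20, 21, 22, 23, 24, 25, 26] s₀ s ∧ s.batch = s₀.batch ∧
        s.nat 26 0 = p + 1 ∧ Lists (s.nat 4) n ∧ SortedBlocks X (s.nat 4) (w + w) n := by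
  set A := [4, 5, 13, 18, 20, 21, 22, 23, 24, 25, 26] with hAdef
  set σ := s₀.nat 4 with hσ
  have hW : 0 < w + w := by omega
  refine (TerminatesIn.seq (t := 3) (u := 69 * n - 3) (terminatesIn_straight (by simp) ?_)).le
    (by omega)
  refine ((TerminatesIn.loop_const (fun b s => Agrees A s₀ s ∧ s.nat 4 = σ ∧
    s.nat 13 0 = w ∧ s.nat 26 0 = p ∧
    s.batch = s₀.batch ∧ s.nat 20 0 = b * (w + w) ∧
    (∀ t < n, t < b * (w + w) → ∃ q < n, s.nat 5 t = σ q) ∧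
    (∀ q < n, q < b * (w + w) → ∃ t < n, t < b * (w + w) ∧ s.nat 5 t = σ q) ∧
    SortedBlocks X (s.nat 5) (w + w) (min (b * (w + w)) n))
    (n ⌈/⌉ (w + w)) (20 * w + 13) ?_ ?_ ?_ ?_).andThen (u := 4 * n + 8) fun s h => ?_).le ?_
  · refine ⟨((Agrees.refl _ _).writeN (by simp [A])).writeN (by simp [A]), ?_, ?_⟩
    · funext t; simp [hσ]
    · simp [h26, hw, SortedBlocks]
  · rintro b hb s ⟨hA, -, -, -, -, h20, -⟩
    have h0 : s.nat 0 0 = n := by rw [hA.nat 0 (by simp [A]), hn]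
    simpa [h0, h20] using (lt_ceilDiv_iff hW).1 hb
  · rintro b hb s ⟨hA, h4, h13, h26', hbt, h20, hsrc, hcon, hsort⟩
    have h0 : s.nat 0 0 = n := by rw [hA.nat 0 (by simp [A]), hn]
    rw [lt_ceilDiv_iff hW] at hb
    have e1 : (b + 1) * (w + w) = b * (w + w) + (w + w) := by ring
    -- The blocks numbered `2 * b` and `2 * b + 1` at width `w` together form the block numbered `b`
    -- at width `w + w`.
    have hdiv (c q : ℕ) (h1 : c * w ≤ q) (h2 : q < c * w + w) : q / w = c :=
      Nat.div_eq_of_lt_le h1 (by rw [add_mul]; omega)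
    have hdiv' (q : ℕ) (h1 : b * (w + w) ≤ q) (h2 : q < b * (w + w) + (w + w)) :
      q / (w + w) = b := Nat.div_eq_of_lt_le h1 (by rw [add_mul]; omega)
    have e2 : 2 * b * w = b * (w + w) := by ring
    have e3 : (2 * b + 1) * w = b * (w + w) + w := by ring
    refine (mergeBlock_spec h0 h13 h20 (by rw [hA.real, hX]) h4 hb ?_ ?_).mono le_rfl ?_
    · intro u v h1 h2 h3
      refine hs u v h2 (by omega) ?_
      rw [hdiv (2 * b) u (by omega) (by omega), hdiv (2 * b) v (by omega) (by omega)]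
    · intro u v h1 h2 h3
      refine hs u v h2 (by omega) ?_
      rw [hdiv (2 * b + 1) u (by omega) (by omega), hdiv (2 * b + 1) v (by omega) (by omega)]
    · rintro s' ⟨hA', hb', h20', h5, hM⟩
      rw [e1]
      refine ⟨hA.trans ⟨fun a ha => hA'.nat a (by simp [A] at ha ⊢; tauto), hA'.real,
        hA'.queries, hA'.rounds⟩ (by simp), by rw [hA'.nat 4 (by simp), h4],
        by rw [hA'.nat 13 (by simp), h13], by rw [hA'.nat 26 (by simp), h26'], hb'.trans hbt,
        h20', ?_, ?_, ?_⟩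
      · intro t ht htb
        rcases Nat.lt_or_ge t (b * (w + w)) with h1 | h1
        · rw [h5 t h1]; exact hsrc t ht h1
        · obtain ⟨q, hq, e⟩ := hM.source t h1 (by omega)
          simp only [Set.mem_ofPred_eq] at hq
          exact ⟨q, by omega, e⟩
      · intro q hq hqb
        rcases Nat.lt_or_ge q (b * (w + w)) with h1 | h1
        · obtain ⟨t, ht, htb, e⟩ := hcon q hq h1
          exact ⟨t, ht, by omega, (h5 t htb).trans e⟩
        · obtain ⟨t, ht, ht', e⟩ := hM.consumed q (by simp; omega) (by simp)
          exact ⟨t, by omega, by omega, e⟩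
      · intro u v huv hv huv'
        rcases Nat.lt_or_ge v (b * (w + w)) with h1 | h1
        · rw [h5 u (by omega), h5 v h1]
          exact hsort u v huv (by omega) huv'
        · rw [hdiv' v h1 (by omega)] at huv'
          have h2 : b * (w + w) ≤ u := by
            rw [← huv']; exact Nat.div_mul_le_self u _
          exact hM.sorted u v h2 huv hv
  · rintro s ⟨hA, -, -, -, -, h20, -⟩
    have h0 : s.nat 0 0 = n := by rw [hA.nat 0 (by simp [A]), hn]
    simpa [h0, h20] using le_ceilDiv_mul n hW
  · obtain ⟨hA, h4, h13, h26', hbt, h20, hsrc, hcon, hsort⟩ := h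
    have h0 : s.nat 0 0 = n := by rw [hA.nat 0 (by simp [A]), hn]
    have hle := le_ceilDiv_mul n hW
    refine (TerminatesIn.seq (t := 1) (u := 4 * n + 4) (terminatesIn_straight (by simp) ?_)).le
      (by omega)
    refine ((TerminatesIn.loop_const (fun i s' => Agrees A s s' ∧ s'.batch = s.batch ∧
      s'.nat 18 0 = i ∧ s'.nat 5 = s.nat 5 ∧ s'.nat 26 0 = p ∧ ∀ j < i, s'.nat 4 j = s.nat 5 j)
      n 3 ?_ ?_ ?_ ?_).andThen (u := 1) fun s' h => ?_).le (by omega)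
    · refine ⟨(Agrees.refl _ _).writeN (by simp [A]), by simp, by simp, ?_, by simpa, by simp⟩
      funext t; simp
    · rintro i hi s' ⟨hA', -, h18, -⟩
      have h0' : s'.nat 0 0 = n := by rw [hA'.nat 0 (by simp [A]), h0]
      simpa [h0', h18] using hi
    · rintro i hi s' ⟨hA', hb', h18, h5, h26'', hj⟩
      refine terminatesIn_straight (by simp) ⟨(hA'.writeN (by simp [A])).writeN (by simp [A]),
        by simpa, by simp [h18], ?_, by simpa, ?_⟩
      · rw [← h5]; funext t; simp
      · intro j hj'
        rcases Nat.lt_or_ge j i with h1 | h1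
        · have := h1.ne
          simpa [h18, this] using hj j h1
        · obtain rfl : j = i := by omega
          simp [h18, h5]
    · rintro s' ⟨hA', -, h18, -⟩
      have h0' : s'.nat 0 0 = n := by rw [hA'.nat 0 (by simp [A]), h0]
      simp [h0', h18]
    · obtain ⟨hA', hb', h18, h5, h26'', hj⟩ := h
      refine terminatesIn_straight (by simp) ⟨hA.trans (hA'.writeN (by simp [A])) (by simp),
        by simpa using hb'.trans hbt, by simp [h26''], ?_, ?_⟩
      · simp only [Cmd.exec]
        rw [writeN_row _ (by simp)]
        refine ⟨fun i hi => ?_, fun v hv => ?_⟩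
        · obtain ⟨q, hq, e⟩ := hsrc i hi (by omega)
          rw [hj i hi, e]
          exact hl.1 q hq
        · obtain ⟨q, hq, rfl⟩ := hl.2 v hv
          obtain ⟨t, ht, -, e⟩ := hcon q hq (by omega)
          exact ⟨t, ht, (hj t ht).trans e⟩
      · simp only [Cmd.exec]
        rw [writeN_row _ (by simp)]
        intro u v huv hv huv'
        rw [hj u (by omega), hj v hv]
        exact hsort u v huv (by omega) huv'
  · have h1 := ceilDiv_mul_le n hW
    set J := n ⌈/⌉ (w + w)
    -- The constant overhead of a merge is absorbed by `w ≥ 1`. Since `w < n`, the blocks have total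
    -- width `J * (w + w) ≤ n + 2 * w < 3 * n`, so the pass is linear.
    have h2 : J * (20 * w + 13 + 1) ≤ 17 * (J * (w + w)) := by
      have : J ≤ J * w := Nat.le_mul_of_pos_right _ hw0
      nlinarith
    omega

theorem mergeSort_spec {n : ℕ} (hn : s₀.nat 0 0 = n) (h26 : s₀.nat 26 0 = 0)
    (h10 : s₀.nat 10 0 = Nat.clog 2 n) (h6 : ∀ p ≤ Nat.clog 2 n, s₀.nat 6 p = 2 ^ p)
    (hX : s₀.real 0 = X) (hl : Lists (s₀.nat 4) n) :
    TerminatesIn O mergeSort s₀ (Nat.clog 2 n * (70 * n + 1) + 1) fun s =>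
      Agrees [4, 5, 13, 18, 20, 21, 22, 23, 24, 25, 26] s₀ s ∧ s.batch = s₀.batch ∧
        Lists (s.nat 4) n ∧ ∀ i j, i ≤ j → j < n → X (s.nat 4 i) ≤ X (s.nat 4 j) := by
  refine (TerminatesIn.loop_const (fun p s =>
    Agrees [4, 5, 13, 18, 20, 21, 22, 23, 24, 25, 26] s₀ s ∧ s.batch = s₀.batch ∧
      s.nat 26 0 = p ∧ Lists (s.nat 4) n ∧ SortedBlocks X (s.nat 4) (2 ^ p) n)
    (Nat.clog 2 n) (70 * n) ?_ ?_ ?_ ?_).mono le_rfl ?_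
  · refine ⟨.refl _ _, rfl, h26, hl, fun p q _ _ h => ?_⟩
    simp at h
    rw [h]
  · rintro p hp s ⟨hA, -, h, -⟩
    have h10' : s.nat 10 0 = Nat.clog 2 n := by rw [hA.nat 10 (by simp), h10]
    simpa [h10', h] using hp
  · rintro p hp s ⟨hA, hb, h, hl', hs⟩
    refine (mergePass_spec (by rw [hA.nat 0 (by simp), hn]) h
      (by rw [hA.nat 6 (by simp), h6 p hp.le]) (by positivity)
      ((Nat.lt_clog_iff_pow_lt (by norm_num)).1 hp) (by rw [hA.real, hX]) hl' hs).mono le_rfl ?_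
    rintro s' ⟨hA', hb', h', hl'', hs'⟩
    refine ⟨hA.trans hA' (by simp), hb'.trans hb, h', hl'', ?_⟩
    rwa [← two_mul, ← pow_succ'] at hs'
  · rintro s ⟨hA, -, h, -⟩
    have h10' : s.nat 10 0 = Nat.clog 2 n := by rw [hA.nat 10 (by simp), h10]
    simp [h10', h]
  · rintro s ⟨hA, hb, -, hl', hs⟩
    refine ⟨hA, hb, hl', fun i j hij hj => hs i j hij hj ?_⟩
    have := Nat.le_pow_clog (b := 2) (by norm_num) n
    rw [Nat.div_eq_of_lt (by omega), Nat.div_eq_of_lt (by omega)]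

end Sorting

/-! ### The search -/

section Search

variable {O : ℕ → ℕ → ℕ} {s s₀ : State} {n d w c j : ℕ} {σ : ℕ → ℕ}

theorem answerRow_enqueue_self (a i k j : ℕ) (l : List Pending) (r : ℕ → ℕ) :
    answerRow O a (l ++ [⟨a, i, k, j⟩]) r = Function.update (answerRow O a l r) i (O k j) := by
  simp [answerRow]

theorem answerRow_enqueue_of_ne {a b : ℕ} (i k j : ℕ) (l : List Pending) (r : ℕ → ℕ)
    (h : b ≠ a) : answerRow O a (l ++ [⟨b, i, k, j⟩]) r = answerRow O a l r := by
  simp [answerRow, h]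

/-- For the last interval `j + w` may be at least `n`, and the index `σ (j + w)` is then
meaningless. The query is still sent and counted, but its answer has no influence, since
`resolveInterval` trusts a comparison only if `j + w < n`. -/
theorem askInterval_spec (hd : s₀.nat 0 1 = d) (hσ : s₀.nat 4 = σ) (hw : s₀.nat 13 0 = w)
    (hj : s₀.nat 14 0 = j) (hc : s₀.nat 15 0 = c) :
    TerminatesIn O askInterval s₀ (6 * d + 3) fun s =>
      Agrees [16] s₀ s ∧ s.batch.length = s₀.batch.length + 2 * d ∧
        (∀ a, a ≠ 2 → a ≠ 3 → ∀ r, answerRow O a s.batch r = answerRow O a s₀.batch r) ∧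
        (∀ r p, answerRow O 2 s.batch r p =
          if c ≤ p ∧ p < c + d then O (p - c) (σ j) else answerRow O 2 s₀.batch r p) ∧
        ∀ r p, answerRow O 3 s.batch r p =
          if c ≤ p ∧ p < c + d then O (p - c) (σ (j + w)) else answerRow O 3 s₀.batch r p := by
  refine (TerminatesIn.seq (t := 1) (u := 6 * d + 1) (terminatesIn_straight (by simp) ?_)).le
    (by omega)
  refine (TerminatesIn.loop_const (fun i s => (Agrees [16] s₀ s ∧
    s.batch.length = s₀.batch.length + 2 * i ∧
    (∀ a, a ≠ 2 → a ≠ 3 → ∀ r, answerRow O a s.batch r = answerRow O a s₀.batch r) ∧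
    (∀ r p, answerRow O 2 s.batch r p =
      if c ≤ p ∧ p < c + i then O (p - c) (σ j) else answerRow O 2 s₀.batch r p) ∧
    ∀ r p, answerRow O 3 s.batch r p =
      if c ≤ p ∧ p < c + i then O (p - c) (σ (j + w)) else answerRow O 3 s₀.batch r p) ∧
    s.nat 16 0 = i) d 5 ?_ ?_ ?_ ?_).mono (by omega) fun s h => h.1
  · refine ⟨⟨(Agrees.refl _ _).writeN (by simp), by simp, by simp, fun r p => ?_, fun r p => ?_⟩,
      by simp⟩ <;> rw [if_neg (by omega)] <;> simp
  · rintro i hi s ⟨⟨hA, -⟩, h⟩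
    have h0 : s.nat 0 1 = d := by rw [hA.nat 0 (by simp), hd]
    simpa [h0, h]
  · rintro i hi s ⟨⟨hA, hl, ha, h2, h3⟩, h⟩
    have h4 : s.nat 4 = σ := by rw [hA.nat 4 (by simp), hσ]
    have h13 : s.nat 13 0 = w := by rw [hA.nat 13 (by simp), hw]
    have h14 : s.nat 14 0 = j := by rw [hA.nat 14 (by simp), hj]
    have h15 : s.nat 15 0 = c := by rw [hA.nat 15 (by simp), hc]
    refine terminatesIn_straight (by simp) ⟨⟨hA.enqueue.enqueue.writeN (by simp),
      by simp [hl]; omega, ?_, ?_, ?_⟩, by simp [h]⟩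
    · intro a ha2 ha3 r
      simp only [Cmd.exec, writeN_batch, enqueue_batch]
      rw [answerRow_enqueue_of_ne _ _ _ _ _ (Ne.symm ha3),
        answerRow_enqueue_of_ne _ _ _ _ _ (Ne.symm ha2), ha a ha2 ha3]
    · intro r p
      simp only [Cmd.exec, writeN_batch, enqueue_batch, enqueue_nat, NExp.eval, h, h4, h14, h15]
      rw [answerRow_enqueue_of_ne _ _ _ _ _ (by simp), answerRow_enqueue_self,
        Function.update_apply, h2]
      by_cases hp : p = c + i
      · subst hp; simp
      · rw [if_neg hp]
        exact if_congr (by omega) rfl rfl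
    · intro r p
      simp only [Cmd.exec, writeN_batch, enqueue_batch, enqueue_nat, NExp.eval, h, h4, h13, h14,
        h15]
      rw [answerRow_enqueue_self, answerRow_enqueue_of_ne _ _ _ _ _ (by simp),
        Function.update_apply, h3]
      by_cases hp : p = c + i
      · subst hp; simp
      · rw [if_neg hp]
        exact if_congr (by omega) rfl rfl
  · rintro s ⟨⟨hA, -⟩, h⟩
    have h0 : s.nat 0 1 = d := by rw [hA.nat 0 (by simp), hd]
    simp [h0, h]

theorem compareEnds_spec (hd : s₀.nat 0 1 = d) (hc : s₀.nat 15 0 = c) :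
    TerminatesIn O compareEnds s₀ (6 * d + 5) fun s =>
      Agrees [16, 17] s₀ s ∧ s.batch = s₀.batch ∧
        (s.nat 17 0 = 0 ↔ ∀ k < d, s₀.nat 2 (c + k) = s₀.nat 3 (c + k)) := by
  refine (TerminatesIn.seq (t := 3) (u := 6 * d + 1) (terminatesIn_straight (by simp) ?_)).le
    (by omega)
  refine (TerminatesIn.loop_const (fun i s => (Agrees [16, 17] s₀ s ∧ s.batch = s₀.batch ∧
    (s.nat 17 0 = 0 ↔ ∀ k < i, s₀.nat 2 (c + k) = s₀.nat 3 (c + k))) ∧ s.nat 16 0 = i) d 5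
    ?_ ?_ ?_ ?_).mono (by omega) fun s h => h.1
  · exact ⟨⟨((Agrees.refl _ _).writeN (by simp)).writeN (by simp), by simp, by simp⟩, by simp⟩
  · rintro i hi s ⟨⟨hA, -⟩, h⟩
    have h0 : s.nat 0 1 = d := by rw [hA.nat 0 (by simp), hd]
    simpa [h0, h]
  · rintro i hi s ⟨⟨hA, hb, he⟩, h⟩
    have h2 : s.nat 2 = s₀.nat 2 := hA.nat 2 (by simp)
    have h3 : s.nat 3 = s₀.nat 3 := hA.nat 3 (by simp)
    have h15 : s.nat 15 0 = c := by rw [hA.nat 15 (by simp), hc]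
    refine terminatesIn_straight (by simp) ?_
    simp only [Cmd.exec, BExp.holds, NExp.eval, h2, h3, h15, h]
    split_ifs with hq
    · refine ⟨⟨hA.writeN (by simp), by simpa, ?_⟩, by simp [h]⟩
      simp only [writeN_nat, Nat.reduceEqDiff, false_and, if_false, he]
      refine ⟨fun H k hk => ?_, fun H k hk => H k (by omega)⟩
      rcases Nat.lt_or_ge k i with h1 | h1
      · exact H k h1
      · obtain rfl : k = i := by omega
        omega
    · refine ⟨⟨(hA.writeN (by simp)).writeN (by simp), by simpa, ?_⟩, by simp [h]⟩
      simp only [writeN_nat, Nat.reduceEqDiff, false_and, and_self, if_false, if_true,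
        one_ne_zero, false_iff]
      intro H
      have := H i (by omega)
      omega
  · rintro s ⟨⟨hA, -⟩, h⟩
    have h0 : s.nat 0 1 = d := by rw [hA.nat 0 (by simp), hd]
    simp [h0, h]

theorem labelInterval_spec (hσ : s₀.nat 4 = σ) (hw : s₀.nat 13 0 = w) (hj : s₀.nat 14 0 = j)
    (hc : s₀.nat 15 0 = c) :
    TerminatesIn O labelInterval s₀ (6 * w + 3) fun s =>
      Agrees [1, 7, 18] s₀ s ∧ s.batch = s₀.batch ∧
        (∀ p, s.nat 7 p = if j ≤ p ∧ p < j + w then 1 else s₀.nat 7 p) ∧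
        (∀ p, j ≤ p → p < j + w → s.nat 1 (σ p) = s₀.nat 2 c) ∧
        ∀ v, (∀ p, j ≤ p → p < j + w → σ p ≠ v) → s.nat 1 v = s₀.nat 1 v := by
  refine (TerminatesIn.seq (t := 1) (u := 6 * w + 1) (terminatesIn_straight (by simp) ?_)).le
    (by omega)
  refine (TerminatesIn.loop_const (fun i s => (Agrees [1, 7, 18] s₀ s ∧ s.batch = s₀.batch ∧
    (∀ p, s.nat 7 p = if j ≤ p ∧ p < j + i then 1 else s₀.nat 7 p) ∧
    (∀ p, j ≤ p → p < j + i → s.nat 1 (σ p) = s₀.nat 2 c) ∧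
    ∀ v, (∀ p, j ≤ p → p < j + i → σ p ≠ v) → s.nat 1 v = s₀.nat 1 v) ∧ s.nat 18 0 = j + i) w 5
    ?_ ?_ ?_ ?_).mono (by omega) fun s h => h.1
  · refine ⟨⟨(Agrees.refl _ _).writeN (by simp), by simp, fun p => ?_, fun p _ _ => by omega,
      by simp⟩, by simp [hj]⟩
    rw [if_neg (by omega)]; simp
  · rintro i hi s ⟨⟨hA, -⟩, h⟩
    have h13 : s.nat 13 0 = w := by rw [hA.nat 13 (by simp), hw]
    have h14 : s.nat 14 0 = j := by rw [hA.nat 14 (by simp), hj]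
    simpa [h13, h14, h]
  · rintro i hi s ⟨⟨hA, hb, h7, h1, h1'⟩, h⟩
    have h4 : s.nat 4 = σ := by rw [hA.nat 4 (by simp), hσ]
    have h2 : s.nat 2 = s₀.nat 2 := hA.nat 2 (by simp)
    have h15 : s.nat 15 0 = c := by rw [hA.nat 15 (by simp), hc]
    refine terminatesIn_straight (by simp) ⟨⟨((hA.writeN (by simp)).writeN (by simp)).writeN
      (by simp), by simpa, ?_, ?_, ?_⟩, by simp [h, add_assoc]⟩
    · intro p
      simp only [Cmd.exec, NExp.eval, h]
      by_cases hp : p = j + i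
      · subst hp; simp
      · simp only [writeN_nat, hp, h7]
        simp only [Nat.reduceEqDiff, false_and, if_false, and_false]
        exact if_congr (by omega) rfl rfl
    · intro p hp hp'
      simp [h, h4, h2, h15]
      intro hne
      refine h1 p hp ?_
      have : p ≠ j + i := by rintro rfl; exact hne rfl
      omega
    · intro v hv
      have : v ≠ σ (j + i) := (hv (j + i) (by omega) (by omega)).symm
      simp [h, h4, this]
      exact h1' v fun p hp hp' => hv p hp (by omega)
  · rintro s ⟨⟨hA, -⟩, h⟩
    have h13 : s.nat 13 0 = w := by rw [hA.nat 13 (by simp), hw]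
    have h14 : s.nat 14 0 = j := by rw [hA.nat 14 (by simp), hj]
    simp [h13, h14, h]

/-- The predicate `active` does not depend on the state, although `p` may change the marks. This
gives a bound that charges `t` only for the active intervals and a constant for the others. -/
theorem forIntervals_spec {p : Cmd} {t : ℕ} (I : ℕ → State → Prop) (active : ℕ → Prop)
    [DecidablePred active]
    (hw : 0 < w) (h0 : I 0 s₀)
    (hI : ∀ i s v, I i s → I i (s.writeN 14 0 v) ∧ I i (s.writeN 15 0 v))
    (hfix : ∀ i s, I i s → s.nat 0 0 = n ∧ s.nat 0 1 = d ∧ s.nat 13 0 = w)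
    (hact : ∀ i s, i * w < n → I i s → (s.nat 7 (i * w) = 0 ↔ active i))
    (hbody : ∀ i s, i * w < n → I i s → s.nat 14 0 = i * w → s.nat 15 0 = i * d → active i →
      TerminatesIn O p s t fun s' => I (i + 1) s' ∧ s'.nat 14 0 = i * w ∧ s'.nat 15 0 = i * d)
    (hskip : ∀ i s, i * w < n → I i s → ¬ active i → I (i + 1) s) :
    TerminatesIn O (forIntervals p) s₀
      (7 * (n ⌈/⌉ w) + ((Finset.range (n ⌈/⌉ w)).filter active).card * t + 5) (I (n ⌈/⌉ w)) := by
  refine (TerminatesIn.seq (t := 3)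
    (u := 7 * (n ⌈/⌉ w) + ((Finset.range (n ⌈/⌉ w)).filter active).card * t + 1)
    (terminatesIn_straight (by simp) ?_)).le (by omega)
  refine (TerminatesIn.loop (fun i s => I i s ∧ s.nat 14 0 = i * w ∧ s.nat 15 0 = i * d)
    (n ⌈/⌉ w) (fun i => 6 + if active i then t else 0) ?_ ?_ ?_ ?_).mono ?_ fun s h => h.1
  · exact ⟨(hI _ _ _ (hI _ _ _ h0).1).2, by simp, by simp⟩
  · rintro i hi s ⟨h, h14, -⟩
    rw [lt_ceilDiv_iff hw] at hi
    simpa [(hfix i s h).1, h14] using hi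
  · rintro i hi s ⟨h, h14, h15⟩
    rw [lt_ceilDiv_iff hw] at hi
    have key : TerminatesIn O (.ite (.leN (.cell 7 (.var 14)) (.lit 0)) p .skip) s
        (1 + (1 + if active i then t else 0))
        fun s' => I (i + 1) s' ∧ s'.nat 14 0 = i * w ∧ s'.nat 15 0 = i * d := by
      refine TerminatesIn.ite (fun hb => ?_) fun hb => ?_
      · simp only [BExp.holds, NExp.eval, h14, Nat.le_zero, hact i s hi h] at hb
        exact (hbody i s hi h h14 h15 hb).le (by simp [hb])
      · simp only [BExp.holds, NExp.eval, h14, Nat.le_zero, hact i s hi h] at hb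
        exact (terminatesIn_skip ⟨hskip i s hi h hb, h14, h15⟩).le (by omega)
    refine (key.andThen (u := 3) fun s' h' => ?_).le (by omega)
    obtain ⟨h', h14', h15'⟩ := h'
    obtain ⟨-, hd, hw'⟩ := hfix _ _ h'
    refine terminatesIn_straight (by simp [advance]) ⟨(hI _ _ _ (hI _ _ _ h').1).2, ?_, ?_⟩
    · simp [advance, h14', hw']; ring
    · simp [advance, h15', hd]; ring
  · rintro s ⟨h, h14, -⟩
    simpa [(hfix _ s h).1, h14] using le_ceilDiv_mul n hw
  · have h : ∑ i ∈ Finset.range (n ⌈/⌉ w), (if active i then t else 0) =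
        ((Finset.range (n ⌈/⌉ w)).filter active).card * t := by
      rw [← Finset.sum_filter, Finset.sum_const, smul_eq_mul]
    simp only [Finset.sum_add_distrib, h, Finset.sum_const, Finset.card_range, smul_eq_mul]
    omega

/-- The answers at the positions `a` and `b` differ for some order. -/
def Differ (O : ℕ → ℕ → ℕ) (d : ℕ) (σ : ℕ → ℕ) (a b : ℕ) : Prop :=
  ∃ k < d, O k (σ a) ≠ O k (σ b)

/-- The labels on the `q`-th interval of width `w` do not follow from the answers at its ends. -/
def Undecided (O : ℕ → ℕ → ℕ) (n d : ℕ) (σ : ℕ → ℕ) (w q : ℕ) : Prop :=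
  n ≤ (q + 1) * w ∨ Differ O d σ (q * w) ((q + 1) * w)

/-- All labels that follow from the answers on the grid of width `w` are known. -/
structure Searched (O : ℕ → ℕ → ℕ) (n d : ℕ) (σ : ℕ → ℕ) (w : ℕ) (s : State) : Prop where
  correct : ∀ p < n, s.nat 7 p ≠ 0 → s.nat 1 (σ p) = O 0 (σ p)
  undecided : ∀ p < n, s.nat 7 p = 0 → w ≠ 1 ∧ Undecided O n d σ w (p / w)
  const : ∀ p < n, s.nat 7 p = s.nat 7 (p / w * w)

/-- Equal answers at two positions determine the labels between them. -/
def Inferable (O : ℕ → ℕ → ℕ) (n d : ℕ) (σ : ℕ → ℕ) : Prop :=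
  ∀ a b, a < b → b < n → ¬ Differ O d σ a b → ∀ p, a ≤ p → p ≤ b → O 0 (σ p) = O 0 (σ a)

open Classical in
/-- On every grid, few pairs of neighbors have different answers. -/
def FewChanges (O : ℕ → ℕ → ℕ) (n d : ℕ) (σ : ℕ → ℕ) : Prop :=
  ∀ w, 0 < w → ((Finset.range n).filter fun q => (q + 1) * w < n ∧
    Differ O d σ (q * w) ((q + 1) * w)).card ≤ 2 * d ^ 2

-- An undecided interval either has differing ends, which `FewChanges` counts, or reaches the end of
-- the sample. Only one interval of the second kind starts below `n`.
open Classical in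
theorem card_undecided_le (h : FewChanges O n d σ) (hw : 0 < w) :
    ((Finset.range n).filter fun q => q * w < n ∧ Undecided O n d σ w q).card ≤ 2 * d ^ 2 + 1 := by
  have hsub : ((Finset.range n).filter fun q => q * w < n ∧ Undecided O n d σ w q) ⊆
      ((Finset.range n).filter fun q => (q + 1) * w < n ∧
        Differ O d σ (q * w) ((q + 1) * w)) ∪
      ((Finset.range n).filter fun q => q * w < n ∧ n ≤ (q + 1) * w) := by
    intro q hq
    rw [Finset.mem_filter] at hq
    rw [Finset.mem_union, Finset.mem_filter, Finset.mem_filter]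
    rcases Nat.lt_or_ge ((q + 1) * w) n with h1 | h1
    · exact Or.inl ⟨hq.1, h1, hq.2.2.resolve_left (by omega)⟩
    · exact Or.inr ⟨hq.1, hq.2.1, h1⟩
  refine (Finset.card_le_card hsub).trans ((Finset.card_union_le _ _).trans ?_)
  refine Nat.add_le_add (h w hw) (Finset.card_le_one.2 fun a ha b hb => ?_)
  simp only [Finset.mem_filter] at ha hb
  have h1 : a < b + 1 := lt_of_mul_lt_mul_right (ha.2.1.trans_le hb.2.2) (Nat.zero_le w)
  have h2 : b < a + 1 := lt_of_mul_lt_mul_right (hb.2.1.trans_le ha.2.2) (Nat.zero_le w)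
  omega

/-- An unmarked interval of width `w` lies in an undecided interval of width `r * w`, and each of
those contains `r` intervals of width `w`. -/
theorem card_active_le (h : FewChanges O n d σ) (hw : 0 < w) {r : ℕ} (hr : 0 < r)
    (hs : Searched O n d σ (r * w) s) :
    ((Finset.range (n ⌈/⌉ w)).filter fun i => s.nat 7 (i * w) = 0).card ≤
      r * (2 * d ^ 2 + 1) := by
  classical
  have hrw : 0 < r * w := Nat.mul_pos hr hw
  refine (Finset.card_le_mul_card_image_of_maps_to (f := fun i => i / r)
    (t := (Finset.range n).filter fun q => q * (r * w) < n ∧ Undecided O n d σ (r * w) q)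
    ?_ r ?_).trans (Nat.mul_le_mul_left r (card_undecided_le h hrw))
  · intro i hi
    rw [Finset.mem_filter, Finset.mem_range, lt_ceilDiv_iff hw] at hi
    have h1 := (hs.undecided _ hi.1 hi.2).2
    rw [Nat.mul_div_mul_right _ _ hw] at h1
    have h2 : i / r * (r * w) < n := by
      rw [← mul_assoc]
      exact (Nat.mul_le_mul_right w (Nat.div_mul_le_self i r)).trans_lt hi.1
    rw [Finset.mem_filter, Finset.mem_range]
    exact ⟨(Nat.le_mul_of_pos_right _ hrw).trans_lt h2, h2, h1⟩
  · intro q _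
    calc _ ≤ (Finset.Ico (q * r) (q * r + r)).card := by
          refine Finset.card_le_card fun i hi => ?_
          simp only [Finset.mem_filter] at hi
          rw [Finset.mem_Ico, ← hi.2]
          exact ⟨Nat.div_mul_le_self i r, by
            rw [← Nat.add_one_mul]; exact Nat.lt_mul_of_div_lt (Nat.lt_succ_self _) hr⟩
      _ = r := by simp

end Search

/-! ### One round of the search, and the search as a whole -/

section Rounds

variable {O : ℕ → ℕ → ℕ} {s s₀ : State} {n d w c j : ℕ} {σ : ℕ → ℕ}

/-- Slot `c` of array `2` holds the answer of order `0` at the left end, which serves as the common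
label. An interval of width one consists of its left end and needs no comparison. -/
theorem resolveInterval_spec (hn : s₀.nat 0 0 = n) (hd : s₀.nat 0 1 = d) (hσ : s₀.nat 4 = σ)
    (hw : s₀.nat 13 0 = w) (hj : s₀.nat 14 0 = j) (hc : s₀.nat 15 0 = c) :
    TerminatesIn O resolveInterval s₀ (6 * d + 6 * w + 10) fun s =>
      Agrees [1, 7, 16, 17, 18] s₀ s ∧ s.batch = s₀.batch ∧
      (((w ≤ 1 ∨ (j + w < n ∧ ∀ k < d, s₀.nat 2 (c + k) = s₀.nat 3 (c + k))) ∧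
        (∀ p, s.nat 7 p = if j ≤ p ∧ p < j + w then 1 else s₀.nat 7 p) ∧
        (∀ p, j ≤ p → p < j + w → s.nat 1 (σ p) = s₀.nat 2 c) ∧
        ∀ v, (∀ p, j ≤ p → p < j + w → σ p ≠ v) → s.nat 1 v = s₀.nat 1 v) ∨
      (¬ (w ≤ 1 ∨ (j + w < n ∧ ∀ k < d, s₀.nat 2 (c + k) = s₀.nat 3 (c + k))) ∧
        s.nat 7 = s₀.nat 7 ∧ s.nat 1 = s₀.nat 1)) := by
  refine ((compareEnds_spec hd hc).andThen (u := 1 + (6 * w + 3)) fun s h => ?_).le (by omega)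
  obtain ⟨hA, hb, he⟩ := h
  have hA' : Agrees [1, 7, 16, 17, 18] s₀ s := (Agrees.refl [] _).trans ⟨fun a ha => hA.nat a (by
    simp at ha ⊢; tauto), hA.real, hA.queries, hA.rounds⟩ (by simp)
  have hn' : s.nat 0 0 = n := by rw [hA.nat 0 (by simp), hn]
  have h13 : s.nat 13 0 = w := by rw [hA.nat 13 (by simp), hw]
  have h14 : s.nat 14 0 = j := by rw [hA.nat 14 (by simp), hj]
  have h15 : s.nat 15 0 = c := by rw [hA.nat 15 (by simp), hc]
  have h4 : s.nat 4 = σ := by rw [hA.nat 4 (by simp), hσ]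
  -- Tests offer only negation and conjunction, so the disjunction is encoded by De Morgan's law.
  have hcond : BExp.holds s (.neg (.conj (.neg (.leN (.var 13) (.lit 1)))
      (.neg (.conj (.leN (.var 17) (.lit 0)) (.lt (.plus (.var 14) (.var 13)) .size))))) ↔
      (w ≤ 1 ∨ (j + w < n ∧ ∀ k < d, s₀.nat 2 (c + k) = s₀.nat 3 (c + k))) := by
    simp only [BExp.holds, NExp.eval, hn', h13, h14, Nat.le_zero, he]
    rw [not_and_or, not_not, not_not, not_le, and_comm (a := ∀ k < d, _)]
  refine TerminatesIn.ite (fun h => ?_) fun h => ?_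
  · refine (labelInterval_spec h4 h13 h14 h15).mono le_rfl ?_
    rintro s' ⟨hA₂, hb₂, h7, h1, h1'⟩
    refine ⟨hA'.trans ⟨fun a ha => hA₂.nat a (by simp at ha ⊢; tauto), hA₂.real, hA₂.queries,
      hA₂.rounds⟩ (by simp), hb₂.trans hb, Or.inl ⟨hcond.1 h, ?_, ?_, ?_⟩⟩
    · simpa only [hA.nat 7 (by simp)] using h7
    · simpa only [hA.nat 2 (by simp)] using h1
    · simpa only [hA.nat 1 (by simp)] using h1'
  · exact (terminatesIn_skip ⟨hA', hb, Or.inr ⟨fun h' => h (hcond.2 h'), hA.nat 7 (by simp),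
      hA.nat 1 (by simp)⟩⟩).le (by omega)

/-- The state after `forIntervals resolveInterval`, when all intervals before the `i`-th one have
been treated. -/
structure Resolved (O : ℕ → ℕ → ℕ) (n d : ℕ) (σ : ℕ → ℕ) (w : ℕ) (s₀ : State) (i : ℕ)
    (s : State) : Prop where
  agrees : Agrees [1, 7, 14, 15, 16, 17, 18] s₀ s
  batch : s.batch = s₀.batch
  correct : ∀ p < n, s.nat 7 p ≠ 0 → s.nat 1 (σ p) = O 0 (σ p)
  undecided : ∀ p < n, p < i * w → s.nat 7 p = 0 → w ≠ 1 ∧ Undecided O n d σ w (p / w)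
  const : ∀ p < n, s.nat 7 p = s.nat 7 (p / w * w)
  same : ∀ p < n, i * w ≤ p → s.nat 7 p = s₀.nat 7 p

theorem Resolved.skip {i : ℕ} (h : Resolved O n d σ w s₀ i s)
    (h7 : s.nat 7 (i * w) ≠ 0) : Resolved O n d σ w s₀ (i + 1) s where
  agrees := h.agrees
  batch := h.batch
  correct := h.correct
  undecided p hp hpi h0 := by
    rcases Nat.lt_or_ge p (i * w) with h1 | h1
    · exact h.undecided p hp h1 h0
    · rw [h.const p hp, Nat.div_eq_of_lt_le h1 hpi] at h0
      exact absurd h0 h7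
  const := h.const
  same p hp hpi := h.same p hp ((Nat.mul_le_mul_right w (Nat.le_succ i)).trans hpi)

theorem Resolved.resolve {i : ℕ} (hw : 0 < w) (hd0 : 0 < d) (hinf : Inferable O n d σ)
    (hn : s₀.nat 0 0 = n) (hd : s₀.nat 0 1 = d) (hσ : s₀.nat 4 = σ) (h13 : s₀.nat 13 0 = w)
    (h14 : s.nat 14 0 = i * w) (h15 : s.nat 15 0 = i * d)
    (h2 : ∀ k < d, s₀.nat 2 (i * d + k) = O k (σ (i * w)))
    (h3 : ∀ k < d, s₀.nat 3 (i * d + k) = O k (σ (i * w + w)))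
    (h : Resolved O n d σ w s₀ i s) :
    TerminatesIn O resolveInterval s (6 * d + 6 * w + 10) fun s' =>
      Resolved O n d σ w s₀ (i + 1) s' ∧ s'.nat 14 0 = i * w ∧ s'.nat 15 0 = i * d := by
  have e1 : (i + 1) * w = i * w + w := by ring
  have e2 (k : ℕ) (hk : k < d) : s.nat 2 (i * d + k) = O k (σ (i * w)) := by
    rw [h.agrees.nat 2 (by simp), h2 k hk]
  have e3 (k : ℕ) (hk : k < d) : s.nat 3 (i * d + k) = O k (σ (i * w + w)) := by
    rw [h.agrees.nat 3 (by simp), h3 k hk]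
  have hdiff : (∀ k < d, s.nat 2 (i * d + k) = s.nat 3 (i * d + k)) ↔
      ¬ Differ O d σ (i * w) (i * w + w) := by
    simp only [Differ, not_exists, not_and, not_not]
    exact forall₂_congr fun k hk => by rw [e2 k hk, e3 k hk]
  refine (resolveInterval_spec (n := n) (d := d) (σ := σ) (w := w)
    (by rw [h.agrees.nat 0 (by simp), hn]) (by rw [h.agrees.nat 0 (by simp), hd])
    (by rw [h.agrees.nat 4 (by simp), hσ]) (by rw [h.agrees.nat 13 (by simp), h13])
    h14 h15).mono le_rfl ?_
  rintro s' ⟨hA, hb, hcase⟩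
  refine ⟨?_, by rw [hA.nat 14 (by simp), h14], by rw [hA.nat 15 (by simp), h15]⟩
  have hA' : Agrees [1, 7, 14, 15, 16, 17, 18] s₀ s' := h.agrees.trans ⟨fun a ha => hA.nat a (by
    simp at ha ⊢; tauto), hA.real, hA.queries, hA.rounds⟩ (by simp)
  have hdiv (p : ℕ) (h1 : i * w ≤ p) (h2 : p < i * w + w) : p / w = i :=
    Nat.div_eq_of_lt_le h1 (by omega)
  rw [hdiff] at hcase
  rcases hcase with ⟨hc, h7, h1, h1'⟩ | ⟨hc, h7, h1⟩
  -- Either the interval is a single position, or its ends agree and `Inferable` applies.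
  · have hlab : ∀ p, i * w ≤ p → p < i * w + w → O 0 (σ p) = O 0 (σ (i * w)) := by
      intro p hp hp'
      rcases hc with hc | hc
      · rw [show p = i * w by omega]
      · exact hinf (i * w) (i * w + w) (by omega) hc.1 hc.2 p hp hp'.le
    have e20 := e2 0 hd0
    rw [Nat.add_zero] at e20
    refine ⟨hA', hb.trans h.batch, ?_, ?_, ?_, ?_⟩
    · intro p hp hp7
      -- Injectivity of `σ` is not available here: the label of `σ p` may have been rewritten
      -- through another position `p'`, but the value written is correct for the same sample point.
      by_cases hex : ∃ p', i * w ≤ p' ∧ p' < i * w + w ∧ σ p' = σ p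
      · obtain ⟨p', h4, h5, h6⟩ := hex
        rw [← h6, h1 p' h4 h5, e20, hlab p' h4 h5]
      · rw [h1' _ fun p' h4 h5 h6 => hex ⟨p', h4, h5, h6⟩]
        refine h.correct p hp ?_
        rw [h7, if_neg fun h4 => hex ⟨p, h4.1, h4.2, rfl⟩] at hp7
        exact hp7
    · intro p hp hpi hp7
      rw [h7] at hp7
      split_ifs at hp7 with h4
      exact h.undecided p hp (by omega) hp7
    · intro p hp
      rw [h7, h7]
      by_cases h4 : i * w ≤ p ∧ p < i * w + w
      · rw [if_pos h4, hdiv p h4.1 h4.2, if_pos (by omega)]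
      · rw [if_neg h4, if_neg, h.const p hp]
        rintro ⟨h5, h6⟩
        rw [← e1] at h6
        have h8 : p / w < i + 1 := lt_of_mul_lt_mul_right h6 (Nat.zero_le w)
        have h9 : i ≤ p / w := le_of_mul_le_mul_right h5 hw
        have h10 := Nat.lt_div_mul_add (a := p) hw
        have h11 := Nat.div_mul_le_self p w
        rw [show p / w = i by omega] at h10 h11
        exact h4 ⟨h11, h10⟩
    · intro p hp hpi
      rw [h7, if_neg (by omega), h.same p hp (by omega)]
  · refine ⟨hA', hb.trans h.batch, ?_, ?_, ?_, ?_⟩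
    · rw [h7, h1]; exact h.correct
    · rw [h7]
      intro p hp hpi hp7
      rcases Nat.lt_or_ge p (i * w) with h4 | h4
      · exact h.undecided p hp h4 hp7
      · rw [hdiv p h4 (by omega), Undecided, e1]
        refine ⟨fun h5 => hc (Or.inl h5.le), ?_⟩
        by_contra! h5
        exact hc (Or.inr ⟨h5.1, h5.2⟩)
    · rw [h7]; exact h.const
    · rw [h7]; exact fun p hp hpi => h.same p hp (by omega)

/-- The `i`-th interval owns the slots from `i * d` to `i * d + d - 1`, so answers for different
intervals never overwrite each other. -/
theorem askAll_spec (hw : 0 < w) (hn : s₀.nat 0 0 = n) (hd : s₀.nat 0 1 = d)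
    (hσ : s₀.nat 4 = σ) (h13 : s₀.nat 13 0 = w) (hb : s₀.batch = []) :
    TerminatesIn O (forIntervals askInterval) s₀
      (7 * (n ⌈/⌉ w) +
        ((Finset.range (n ⌈/⌉ w)).filter fun i => s₀.nat 7 (i * w) = 0).card * (6 * d + 3) + 5)
      fun s => Agrees [14, 15, 16] s₀ s ∧
        s.batch.length = 2 * d *
          ((Finset.range (n ⌈/⌉ w)).filter fun i => s₀.nat 7 (i * w) = 0).card ∧
        (∀ a, a ≠ 2 → a ≠ 3 → ∀ r, answerRow O a s.batch r = r) ∧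
        ∀ r, ∀ i < n ⌈/⌉ w, s₀.nat 7 (i * w) = 0 → ∀ k < d,
          answerRow O 2 s.batch r (i * d + k) = O k (σ (i * w)) ∧
          answerRow O 3 s.batch r (i * d + k) = O k (σ (i * w + w)) := by
  refine forIntervals_spec (n := n) (d := d) (fun i s => Agrees [14, 15, 16] s₀ s ∧
    s.batch.length = 2 * d * ((Finset.range i).filter fun i => s₀.nat 7 (i * w) = 0).card ∧
    (∀ a, a ≠ 2 → a ≠ 3 → ∀ r, answerRow O a s.batch r = r) ∧
    ∀ r, ∀ i' < i, s₀.nat 7 (i' * w) = 0 → ∀ k < d,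
      answerRow O 2 s.batch r (i' * d + k) = O k (σ (i' * w)) ∧
      answerRow O 3 s.batch r (i' * d + k) = O k (σ (i' * w + w)))
    (fun i => s₀.nat 7 (i * w) = 0) hw ?_ ?_ ?_ ?_ ?_ ?_
  · exact ⟨.refl _ _, by simp [hb], by simp [hb, answerRow], by simp⟩
  · rintro i s v ⟨hA, h⟩
    exact ⟨⟨hA.writeN (by simp), h⟩, ⟨hA.writeN (by simp), h⟩⟩
  · rintro i s ⟨hA, -⟩
    rw [hA.nat 0 (by simp), hA.nat 13 (by simp)]
    exact ⟨hn, hd, h13⟩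
  · rintro i s hi ⟨hA, -⟩
    rw [hA.nat 7 (by simp)]
  · rintro i s hi ⟨hA, hl, ha, hans⟩ h14 h15 hact
    refine (askInterval_spec (by rw [hA.nat 0 (by simp), hd]) (by rw [hA.nat 4 (by simp), hσ])
      (by rw [hA.nat 13 (by simp), h13]) h14 h15).mono le_rfl ?_
    rintro s' ⟨hA', hl', ha', h2, h3⟩
    refine ⟨⟨hA.trans ⟨fun a ha => hA'.nat a (by simp at ha ⊢; tauto), hA'.real, hA'.queries,
      hA'.rounds⟩ (by simp), ?_, ?_, ?_⟩, by rw [hA'.nat 14 (by simp), h14],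
      by rw [hA'.nat 15 (by simp), h15]⟩
    · rw [hl', hl, Finset.range_add_one, Finset.filter_insert, if_pos hact,
        Finset.card_insert_of_notMem (by simp)]
      ring
    · intro a h4 h5 r
      rw [ha' a h4 h5, ha a h4 h5]
    · intro r i' hi' hact' k hk
      rw [h2, h3]
      rcases Nat.lt_or_ge i' i with h4 | h4
      · have : i' * d + d ≤ i * d := by
          rw [← Nat.add_one_mul]; exact Nat.mul_le_mul_right d h4
        rw [if_neg (by omega), if_neg (by omega)]
        exact hans r i' h4 hact' k hk
      · obtain rfl : i' = i := by omega
        rw [if_pos (by omega), if_pos (by omega), Nat.add_sub_cancel_left]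
        exact ⟨rfl, rfl⟩
  · rintro i s hi ⟨hA, hl, ha, hans⟩ hact
    refine ⟨hA, ?_, ha, fun r i' hi' hact' k hk => ?_⟩
    · rw [hl, Finset.range_add_one, Finset.filter_insert, if_neg hact]
    · refine hans r i' ?_ hact' k hk
      rcases Nat.lt_or_ge i' i with h4 | h4
      · exact h4
      · obtain rfl : i' = i := by omega
        exact absurd hact' hact

/-- Up to constants the round takes time `n ⌈/⌉ w + act * (d + w)`. Here `act * w` is at most `2 *
n`, because the whole grid has no larger total width, and `act * d` is at most `3 * n` by `hdn`;
this is why the learner tests `d ^ 3 * 2 ^ κ ≤ n`. The `2 * d` queries per active interval give the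
constant `6`. As `Agrees` fixes the counters, the final state is compared with a copy of `s₀` whose
counters have been adjusted. -/
theorem refine_spec {e e' κ : ℕ} (hn : s₀.nat 0 0 = n) (hd : s₀.nat 0 1 = d) (hd0 : 0 < d)
    (hσ : s₀.nat 4 = σ) (hb : s₀.batch = []) (h11 : s₀.nat 11 0 = κ) (h12 : s₀.nat 12 0 = e)
    (he' : e' = e - κ) (h6 : s₀.nat 6 e' = 2 ^ e') (he'n : 2 ^ e' ≤ n)
    (hinf : Inferable O n d σ) (hfew : FewChanges O n d σ) (hs : Searched O n d σ (2 ^ e) s₀)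
    (hdn : d ^ 3 * 2 ^ κ ≤ n) :
    TerminatesIn O refine s₀ (100 * n + 20) fun s =>
      Agrees [1, 2, 3, 7, 12, 13, 14, 15, 16, 17, 18] { s₀ with
        queries := s.queries
        rounds := s₀.rounds + 1 } s ∧
      s.batch = [] ∧ s.queries ≤ s₀.queries + 6 * d ^ 3 * 2 ^ κ ∧ s.nat 12 0 = e' ∧
      Searched O n d σ (2 ^ e') s := by
  set w := 2 ^ e' with hwdef
  have hw : 0 < w := by positivity
  -- Subtraction is truncated, so `r` may be smaller than `κ` in the last round.
  obtain ⟨r, hr⟩ : ∃ r, e = e' + r := Nat.exists_eq_add_of_le (by omega)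
  have hrκ : 2 ^ r ≤ 2 ^ κ := Nat.pow_le_pow_right (by norm_num) (by omega)
  have hrw : 2 ^ e = 2 ^ r * w := by rw [hr, pow_add, mul_comm]
  rw [hrw] at hs
  set act := ((Finset.range (n ⌈/⌉ w)).filter fun i => s₀.nat 7 (i * w) = 0).card with hact
  have hcard : act ≤ 3 * d ^ 2 * 2 ^ κ := by
    refine (card_active_le hfew hw (by positivity) hs).trans ?_
    rw [mul_comm]
    refine Nat.mul_le_mul ?_ hrκ
    have : 0 < d ^ 2 := by positivity
    omega
  have hcardJ : act ≤ n ⌈/⌉ w := by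
    simpa using Finset.card_filter_le (Finset.range (n ⌈/⌉ w)) fun i => s₀.nat 7 (i * w) = 0
  have hJw : (n ⌈/⌉ w) * w ≤ 2 * n := (ceilDiv_mul_le n hw).trans (by omega)
  have hJn : n ⌈/⌉ w ≤ n := by
    rw [ceilDiv_le_iff_le_mul hw]; exact Nat.le_mul_of_pos_left _ hw
  have hactd : act * d ≤ 3 * (d ^ 3 * 2 ^ κ) :=
    (Nat.mul_le_mul_right d hcard).trans (by apply le_of_eq; ring)
  have hactw : act * w ≤ 2 * n := (Nat.mul_le_mul_right w hcardJ).trans hJw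
  set s₁ := Cmd.exec O (.seq (.assign 12 (.minus (.var 12) (.var 11)))
    (.assign 13 (.cell 6 (.var 12)))) s₀ with hs₁
  have hA₁ : Agrees [12, 13] s₀ s₁ := ((Agrees.refl _ _).writeN (by simp)).writeN (by simp)
  have e12 : s₁.nat 12 0 = e' := by simp [hs₁, h11, h12, he']
  have e13 : s₁.nat 13 0 = w := by simp [hs₁, h11, h12, ← he', h6]
  have e7 : s₁.nat 7 = s₀.nat 7 := hA₁.nat 7 (by simp)
  refine (TerminatesIn.seq (t := 3)
    (u := 1 + (7 * (n ⌈/⌉ w) + act * (6 * d + 3) + 5) +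
      (1 + 1 + (7 * (n ⌈/⌉ w) + act * (6 * d + 6 * w + 10) + 5)))
    (terminatesIn_straight (by simp) ?_)).le ?_
  · have hask := askAll_spec (O := O) hw (by rw [hA₁.nat 0 (by simp), hn])
      (by rw [hA₁.nat 0 (by simp), hd]) (by rw [hA₁.nat 4 (by simp), hσ]) e13
      (by simp [hs₁, hb])
    simp only [e7] at hask
    refine hask.andThen fun s₂ h => TerminatesIn.seq (terminatesIn_submit ?_)
    obtain ⟨hA₂, hlen, hoth, hans⟩ := h
    set s₃ := s₂.send O with hs₃
    have n₃ (a : ℕ) (h2 : a ≠ 2) (h3 : a ≠ 3) : s₃.nat a = s₂.nat a := by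
      simp only [hs₃, send_eq]; exact hoth a h2 h3 _
    have hA₃ (a : ℕ) (ha : a ∉ [2, 3, 12, 13, 14, 15, 16]) : s₃.nat a = s₀.nat a := by
      rw [n₃ a (by rintro rfl; simp at ha) (by rintro rfl; simp at ha),
        hA₂.nat a (by simp at ha ⊢; tauto), hA₁.nat a (by simp at ha ⊢; tauto)]
    have f7 : s₃.nat 7 = s₀.nat 7 := hA₃ 7 (by simp)
    have f1 : s₃.nat 1 = s₀.nat 1 := hA₃ 1 (by simp)
    have f0 : s₃.nat 0 = s₀.nat 0 := hA₃ 0 (by simp)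
    have f4 : s₃.nat 4 = s₀.nat 4 := hA₃ 4 (by simp)
    have f13 : s₃.nat 13 0 = w := by
      rw [n₃ 13 (by simp) (by simp), hA₂.nat 13 (by simp), e13]
    have f12 : s₃.nat 12 0 = e' := by
      rw [n₃ 12 (by simp) (by simp), hA₂.nat 12 (by simp), e12]
    have g2 (i : ℕ) (hi : i * w < n) (h7 : s₀.nat 7 (i * w) = 0) (k : ℕ) (hk : k < d) :
        s₃.nat 2 (i * d + k) = O k (σ (i * w)) ∧
          s₃.nat 3 (i * d + k) = O k (σ (i * w + w)) := by
      have hi' := (lt_ceilDiv_iff hw).2 hi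
      simp only [hs₃, send_eq]
      exact ⟨(hans _ i hi' h7 k hk).1, (hans _ i hi' h7 k hk).2⟩
    have hiw (i : ℕ) : i * w / w * w = i * w := by rw [Nat.mul_div_cancel _ hw]
    refine (forIntervals_spec (n := n) (d := d) (w := w) (Resolved O n d σ w s₃)
      (fun i => s₀.nat 7 (i * w) = 0) hw ?_ ?_ ?_ ?_ ?_ ?_).mono le_rfl ?_
    · refine ⟨.refl _ _, rfl, ?_, by simp, ?_, fun _ _ _ => rfl⟩
      · rw [f7, f1]; exact hs.correct
      · intro p hp
        have h1 : p / w * w < n := (Nat.div_mul_le_self p w).trans_lt hp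
        rw [f7, hs.const p hp, hs.const _ h1]
        -- The old marks are constant on the coarse intervals, and `p` lies in the same coarse
        -- interval as the left end of its fine interval.
        congr 2
        rw [mul_comm (2 ^ r), ← Nat.div_div_eq_div_mul, ← Nat.div_div_eq_div_mul,
          Nat.mul_div_cancel _ hw]
    · intro i s v h
      constructor
      · exact ⟨h.agrees.writeN (by simp), h.batch, h.correct, h.undecided, h.const, h.same⟩
      · exact ⟨h.agrees.writeN (by simp), h.batch, h.correct, h.undecided, h.const, h.same⟩
    · intro i s h
      rw [h.agrees.nat 0 (by simp), h.agrees.nat 13 (by simp), f0]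
      exact ⟨hn, hd, f13⟩
    · intro i s hi h
      rw [h.same _ hi le_rfl, f7]
    · intro i s hi h h14 h15 hi7
      exact h.resolve hw hd0 hinf (by rw [f0, hn]) (by rw [f0, hd]) (by rw [f4, hσ]) f13 h14
        h15 (fun k hk => (g2 i hi hi7 k hk).1) (fun k hk => (g2 i hi hi7 k hk).2)
    · intro i s hi h hi7
      refine h.skip ?_
      rwa [h.same _ hi le_rfl, f7]
    · intro s h
      have hq : s.queries = s₀.queries + 2 * d * act := by
        rw [h.agrees.queries, hs₃, send_eq, hlen, hA₂.queries, hA₁.queries]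
      refine ⟨⟨fun a ha => ?_, ?_, rfl, ?_⟩, ?_, ?_, ?_, ?_⟩
      · rw [h.agrees.nat a (by simp at ha ⊢; tauto)]
        exact hA₃ a (by simp at ha ⊢; tauto)
      · rw [h.agrees.real, hs₃, send_eq, hA₂.real, hA₁.real]
      · rw [h.agrees.rounds, hs₃, send_eq, hA₂.rounds, hA₁.rounds]
      · rw [h.batch, hs₃, send_eq]
      · rw [hq]
        nlinarith
      · rw [h.agrees.nat 12 (by simp), f12]
      · exact ⟨h.correct, fun p hp => h.undecided p hp (hp.trans_le (le_ceilDiv_mul n hw)),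
          h.const⟩
  · nlinarith

theorem search_spec {L κ : ℕ} (hn : s₀.nat 0 0 = n) (hd : s₀.nat 0 1 = d) (hd0 : 0 < d)
    (hn2 : 2 ≤ n) (hl : Lists (s₀.nat 4) n) (hσ : s₀.nat 4 = σ) (hb : s₀.batch = [])
    (hL : L = Nat.clog 2 n)
    (h6 : ∀ p ≤ L, s₀.nat 6 p = 2 ^ p) (h7 : ∀ p, s₀.nat 7 p = 0) (h10 : s₀.nat 10 0 = L)
    (h11 : s₀.nat 11 0 = κ) (hκ : 0 < κ)
    (hinf : Inferable O n d σ) (hfew : FewChanges O n d σ) (hdn : d ^ 3 * 2 ^ κ ≤ n) :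
    TerminatesIn O search s₀ (L ⌈/⌉ κ * (100 * n + 21) + 3) fun s =>
      (∀ v < n, s.nat 1 v = O 0 v) ∧
      s.queries ≤ s₀.queries + L ⌈/⌉ κ * (6 * d ^ 3 * 2 ^ κ) ∧
      s.rounds = s₀.rounds + L ⌈/⌉ κ := by
  have hL0 : 0 < L := by rw [hL]; exact Nat.clog_pos (by norm_num) hn2
  have hnL : n ≤ 2 ^ L := by rw [hL]; exact Nat.le_pow_clog (by norm_num) n
  refine (TerminatesIn.seq (t := 1) (u := L ⌈/⌉ κ * (100 * n + 21) + 1)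
    (terminatesIn_straight (by simp) ?_)).le (by omega)
  refine (TerminatesIn.loop_const (fun i s =>
    (∀ a ∉ [1, 2, 3, 7, 12, 13, 14, 15, 16, 17, 18], s.nat a = s₀.nat a) ∧ s.batch = [] ∧
    s.queries ≤ s₀.queries + i * (6 * d ^ 3 * 2 ^ κ) ∧ s.rounds = s₀.rounds + i ∧
    s.nat 12 0 = L - i * κ ∧ Searched O n d σ (2 ^ (L - i * κ)) s) (L ⌈/⌉ κ) (100 * n + 20)
    ?_ ?_ ?_ ?_).mono le_rfl ?_
  · refine ⟨fun a ha => writeN_row s₀ (by rintro rfl; simp at ha), by simpa, by simp, by simp,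
      by simp [h10], ⟨?_, ?_, ?_⟩⟩
    · intro p _ hp; simp [h7] at hp
    -- The initial grid has width `2 ^ L ≥ n`: its only interval overhangs the sample and is
    -- undecided without any query. The width is not `1` because `L > 0`.
    · intro p hp _
      refine ⟨(Nat.one_lt_two_pow (by omega)).ne', Or.inl ?_⟩
      rw [Nat.zero_mul, Nat.sub_zero]
      exact hnL.trans (Nat.le_mul_of_pos_left _ (Nat.succ_pos _))
    · intro p hp; simp [h7]
  · rintro i hi s ⟨-, -, -, -, h12, -⟩
    rw [lt_ceilDiv_iff hκ] at hi
    simp [h12]; omega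
  · rintro i hi s ⟨hA, hb', hq, hr, h12, hs⟩
    rw [lt_ceilDiv_iff hκ] at hi
    have e1 : (i + 1) * κ = i * κ + κ := by ring
    have hpow : 2 ^ (L - (i + 1) * κ) ≤ n := by
      refine ((Nat.lt_clog_iff_pow_lt (b := 2) (by norm_num)).1 ?_).le
      rw [← hL]; omega
    refine (refine_spec (by rw [hA 0 (by simp), hn]) (by rw [hA 0 (by simp), hd]) hd0
      (by rw [hA 4 (by simp), hσ]) hb' (by rw [hA 11 (by simp), h11]) h12
      (e' := L - (i + 1) * κ) (by omega) (by rw [hA 6 (by simp), h6 _ (by omega)]) hpow hinf hfew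
      hs hdn).mono le_rfl ?_
    rintro s' ⟨hA', hb₂, hq', h12', hs'⟩
    refine ⟨fun a ha => (hA'.nat a ha).trans (hA a ha), hb₂, ?_, ?_, h12', hs'⟩
    · rw [add_mul]; omega
    · rw [hA'.rounds]; simp [hr, add_assoc]
  · rintro s ⟨-, -, -, -, h12, -⟩
    have := le_ceilDiv_mul L hκ
    simp [h12]; omega
  · rintro s ⟨-, -, hq, hr, -, hs⟩
    refine ⟨fun v hv => ?_, hq, hr⟩
    obtain ⟨p, hp, rfl⟩ := hl.2 v hv
    -- The final width is `1`, where an unmarked position would contradict `undecided`.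
    have h0 : L - L ⌈/⌉ κ * κ = 0 := by have := le_ceilDiv_mul L hκ; omega
    rw [h0, pow_zero] at hs
    rw [hσ]
    exact hs.correct p hp fun h => (hs.undecided p hp h).1 rfl

end Rounds

/-! ### Signs of derivatives -/

section Signs

open Polynomial

theorem signBit_eq_iff {a b : ℝ} : signBit a = signBit b ↔ (0 ≤ a ↔ 0 ≤ b) := by
  unfold signBit
  split_ifs with h1 h2 h2 <;> simp [h1, h2]

/-- If the derivatives of a polynomial have the same signs at both ends of an interval, then the
sign of the polynomial is constant on the interval. -/
theorem nonneg_iff_of_derivatives {d : ℕ} {f : ℝ[X]} (hf : f.natDegree ≤ d) {a b : ℝ}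
    (h : ∀ k < d, (0 ≤ (derivative^[k] f).eval a ↔ 0 ≤ (derivative^[k] f).eval b))
    {y : ℝ} (hay : a ≤ y) (hyb : y ≤ b) : 0 ≤ f.eval y ↔ 0 ≤ f.eval a := by
  induction d generalizing f y with
  | zero =>
    rw [eq_C_of_natDegree_eq_zero (Nat.le_zero.1 hf)]
    simp
  | succ d ih =>
    have hd : (derivative f).natDegree ≤ d := (natDegree_derivative_le f).trans (by omega)
    -- The induction hypothesis for `f'` makes its sign constant on the interval. Hence `f` is
    -- monotone or antitone there, and its values are squeezed between end values of equal sign.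
    have hsign (y : ℝ) (h1 : a ≤ y) (h2 : y ≤ b) :
        0 ≤ (derivative f).eval y ↔ 0 ≤ (derivative f).eval a :=
      ih hd (fun k hk => h (k + 1) (by omega)) h1 h2
    have h0 : 0 ≤ f.eval a ↔ 0 ≤ f.eval b := h 0 (by omega)
    have ha : a ∈ Set.Icc a b := ⟨le_rfl, hay.trans hyb⟩
    have hb : b ∈ Set.Icc a b := ⟨hay.trans hyb, le_rfl⟩
    have hy : y ∈ Set.Icc a b := ⟨hay, hyb⟩
    by_cases hpos : 0 ≤ (derivative f).eval a
    · have hm : MonotoneOn (fun y => f.eval y) (Set.Icc a b) := by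
        refine monotoneOn_of_deriv_nonneg (convex_Icc a b) f.continuous.continuousOn
          f.differentiable.differentiableOn fun y hy => ?_
        rw [interior_Icc] at hy
        rw [Polynomial.deriv]
        exact (hsign y hy.1.le hy.2.le).2 hpos
      exact ⟨fun h1 => h0.2 (h1.trans (hm hy hb hyb)), fun h1 => h1.trans (hm ha hy hay)⟩
    · have hm : AntitoneOn (fun y => f.eval y) (Set.Icc a b) := by
        refine antitoneOn_of_deriv_nonpos (convex_Icc a b) f.continuous.continuousOn
          f.differentiable.differentiableOn fun y hy => ?_
        rw [interior_Icc] at hy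
        rw [Polynomial.deriv]
        exact (not_le.1 fun h1 => hpos ((hsign y hy.1.le hy.2.le).1 h1)).le
      exact ⟨fun h1 => h1.trans (hm ha hy hay), fun h1 => (h0.1 h1).trans (hm hy hb hyb)⟩

theorem exists_root_of_signBit_ne {g : ℝ[X]} {a b : ℝ} (hab : a ≤ b)
    (h : signBit (g.eval a) ≠ signBit (g.eval b)) : ∃ y ∈ Set.Icc a b, g.eval y = 0 := by
  rw [Ne, signBit_eq_iff] at h
  have hc : ContinuousOn (fun y => g.eval y) (Set.Icc a b) := g.continuous.continuousOn
  rcases le_or_gt 0 (g.eval a) with h1 | h1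
  · have h2 : g.eval b < 0 := by by_contra! h2; exact h (by simp [h1, h2])
    exact intermediate_value_Icc' hab hc ⟨h2.le, h1⟩
  · have h2 : 0 ≤ g.eval b := by
      by_contra! h2; exact h (iff_of_false h1.not_ge h2.not_ge)
    exact intermediate_value_Icc hab hc ⟨h1.le, h2⟩

open Classical in
/-- Along an increasing sequence, the sign of a polynomial changes at most twice for each root. -/
theorem card_signBit_ne_le {g : ℝ[X]} {m : ℕ} (hg : g.natDegree ≤ m) {z : ℕ → ℝ} {n w : ℕ}
    (hz : StrictMonoOn z (Set.Iio n)) (hw : 0 < w) :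
    ((Finset.range n).filter fun q => (q + 1) * w < n ∧
      signBit (g.eval (z (q * w))) ≠ signBit (g.eval (z ((q + 1) * w)))).card ≤ 2 * m := by
  set S := (Finset.range n).filter fun q => (q + 1) * w < n ∧
      signBit (g.eval (z (q * w))) ≠ signBit (g.eval (z ((q + 1) * w))) with hS
  have hmem (q : ℕ) (hq : q ∈ S) : q * w < n ∧ (q + 1) * w < n ∧
      signBit (g.eval (z (q * w))) ≠ signBit (g.eval (z ((q + 1) * w))) := by
    have h1 := (Finset.mem_filter.1 hq).2
    exact ⟨(Nat.mul_le_mul_right w (Nat.le_succ q)).trans_lt h1.1, h1⟩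
  -- The interval has to be closed: zero counts as positive, so the root may be an end point.
  have hroot (q : ℕ) (hq : q ∈ S) :
      ∃ y ∈ Set.Icc (z (q * w)) (z ((q + 1) * w)), g.eval y = 0 := by
    obtain ⟨h1, h2, h3⟩ := hmem q hq
    exact exists_root_of_signBit_ne (hz.monotoneOn h1 h2 (Nat.mul_le_mul_right w (Nat.le_succ q)))
      h3
  choose! ρ hρ hρ0 using hroot
  refine (Finset.card_le_mul_card_image_of_maps_to (f := ρ) (t := g.roots.toFinset) ?_ 2 ?_).trans
    (Nat.mul_le_mul_left 2 (g.roots.toFinset_card_le.trans (g.card_roots'.trans hg)))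
  · intro q hq
    have hg0 : g ≠ 0 := by rintro rfl; exact (hmem q hq).2.2 (by simp)
    rw [Multiset.mem_toFinset, mem_roots hg0]
    exact hρ0 q hq
  · intro y _
    rcases (S.filter fun q => ρ q = y).eq_empty_or_nonempty with h0 | h0
    · rw [h0]; simp
    · obtain ⟨q₀, hq₀, hmin⟩ := Finset.exists_min_image _ id h0
      -- Intervals with a common root intersect, and grid intervals intersect only if they are equal
      -- or adjacent.
      have hsub : (S.filter fun q => ρ q = y) ⊆ {q₀, q₀ + 1} := by
        intro q hq
        rw [Finset.mem_filter] at hq hq₀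
        have h1 := hmin q (Finset.mem_filter.2 hq)
        have h2 : z (q * w) ≤ z ((q₀ + 1) * w) :=
          (hρ q hq.1).1.trans ((hq.2.trans hq₀.2.symm).le.trans (hρ q₀ hq₀.1).2)
        rw [hz.le_iff_le (hmem q hq.1).1 (hmem q₀ hq₀.1).2.1] at h2
        have h3 := le_of_mul_le_mul_right h2 hw
        simp only [id] at h1
        simp only [Finset.mem_insert, Finset.mem_singleton]
        omega
      exact (Finset.card_le_card hsub).trans Finset.card_le_two

variable {n d : ℕ} {x : Fin n → ℝ} {f : ℝ[X]} {X : ℕ → ℝ} {σ : ℕ → ℕ}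

theorem derivOracle_of_lt {k p : ℕ} (hX : ∀ i (h : i < n), X i = x ⟨i, h⟩) (hk : k < d)
    (hp : p < n) : derivOracle d x f k p = signBit ((derivative^[k] f).eval (X p)) := by
  rw [derivOracle, dif_pos ⟨hk, hp⟩, hX p hp]

theorem inferable_derivOracle (hf : f.natDegree ≤ d) (hd : 0 < d)
    (hX : ∀ i (h : i < n), X i = x ⟨i, h⟩) (hσ : ∀ i < n, σ i < n)
    (hz : StrictMonoOn (fun p => X (σ p)) (Set.Iio n)) :
    Inferable (derivOracle d x f) n d σ := by
  intro a b hab hb h p hap hpb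
  have ho (k : ℕ) (hk : k < d) (q : ℕ) (hq : q < n) := derivOracle_of_lt (f := f) hX hk (hσ q hq)
  simp only [Differ, not_exists, not_and, not_not] at h
  rw [ho 0 hd p (by omega), ho 0 hd a (by omega), signBit_eq_iff]
  refine nonneg_iff_of_derivatives (b := X (σ b)) hf (fun k hk => ?_)
    (hz.monotoneOn (Set.mem_Iio.2 (by omega)) (Set.mem_Iio.2 (by omega)) hap)
    (hz.monotoneOn (Set.mem_Iio.2 (by omega)) (Set.mem_Iio.2 (by omega)) hpb)
  rw [← signBit_eq_iff, ← ho k hk a (by omega), ← ho k hk b hb]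
  exact h k hk

/-- Differing ends mean a sign change of some derivative. Each of the `d` derivatives has degree at
most `d`, hence at most `2 * d` changes on the grid. -/
theorem fewChanges_derivOracle (hf : f.natDegree ≤ d)
    (hX : ∀ i (h : i < n), X i = x ⟨i, h⟩) (hσ : ∀ i < n, σ i < n)
    (hz : StrictMonoOn (fun p => X (σ p)) (Set.Iio n)) :
    FewChanges (derivOracle d x f) n d σ := by
  classical
  intro w hw
  have hsub : ((Finset.range n).filter fun q => (q + 1) * w < n ∧
      Differ (derivOracle d x f) d σ (q * w) ((q + 1) * w)) ⊆
      (Finset.range d).biUnion fun k => (Finset.range n).filter fun q => (q + 1) * w < n ∧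
        signBit ((derivative^[k] f).eval (X (σ (q * w)))) ≠
          signBit ((derivative^[k] f).eval (X (σ ((q + 1) * w)))) := by
    intro q hq
    rw [Finset.mem_filter] at hq
    obtain ⟨hq, hqn, k, hk, hne⟩ := hq
    rw [derivOracle_of_lt hX hk (hσ _ ((Nat.mul_le_mul_right w (Nat.le_succ q)).trans_lt hqn)),
      derivOracle_of_lt hX hk (hσ _ hqn)] at hne
    rw [Finset.mem_biUnion]
    exact ⟨k, Finset.mem_range.2 hk, Finset.mem_filter.2 ⟨hq, hqn, hne⟩⟩
  calc _ ≤ _ := Finset.card_le_card (by convert hsub)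
    _ ≤ (Finset.range d).card * (2 * d) := by
      refine Finset.card_biUnion_le_card_mul _ _ _ fun k _ => ?_
      refine card_signBit_ne_le ?_ hz hw
      exact (natDegree_iterate_derivative f k).trans ((Nat.sub_le _ _).trans hf)
    _ = 2 * d ^ 2 := by rw [Finset.card_range]; ring

/-- A surjective self-map of a finite set is injective, so the sorted sequence repeats no sample
point. -/
theorem Lists.strictMonoOn (hl : Lists σ n) (hx : Function.Injective x)
    (hX : ∀ i (h : i < n), X i = x ⟨i, h⟩)
    (hs : ∀ i j, i ≤ j → j < n → X (σ i) ≤ X (σ j)) :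
    StrictMonoOn (fun p => X (σ p)) (Set.Iio n) := by
  have hsurj : Function.Surjective fun i : Fin n => (⟨σ i, hl.1 i i.2⟩ : Fin n) := by
    intro v
    obtain ⟨i, hi, e⟩ := hl.2 v v.2
    exact ⟨⟨i, hi⟩, Fin.ext e⟩
  have hinj := Finite.injective_iff_surjective.2 hsurj
  intro i hi j hj hij
  refine lt_of_le_of_ne (hs i j hij.le hj) fun h => ?_
  simp only [hX _ (hl.1 i hi), hX _ (hl.1 j hj)] at h
  exact hij.ne (congrArg Fin.val (hinj (a₁ := ⟨i, hi⟩) (a₂ := ⟨j, hj⟩) (hx h)))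

end Signs

/-! ### The learner -/

section Learner

variable {n d : ℕ} {α : ℝ} {x : Fin n → ℝ} {f : ℝ[X]}

-- The two branches share one bound. When `n < d ^ 3 * 2 ^ κ`, the single batch of `n` queries fits
-- into the budget of one search round, and there is at least one round in the bound. Sorting is
-- charged only if `x` is not strictly monotone, since otherwise the scan leaves its flag at `0`.
open Classical in
theorem learner_spec (hd : 0 < d) (hn : 2 ≤ n) (hα : 0 < α) (hα1 : α ≤ 1)
    (hx : Function.Injective x) (hf : f.natDegree ≤ d) {L κ : ℕ} (hL : L = Nat.clog 2 n)
    (hκ : κ = ⌈α * L⌉₊) :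
    TerminatesIn (derivOracle d x f) learner (init learner d α x).state
      (50 * n + 121 * (n * (L ⌈/⌉ κ)) + if StrictMono x then 0 else 72 * (n * L)) fun s =>
      (∀ j : Fin n, s.nat 1 j = signBit (f.eval (x j))) ∧
        s.queries ≤ L ⌈/⌉ κ * (6 * d ^ 3 * 2 ^ κ) ∧ s.rounds ≤ L ⌈/⌉ κ := by
  set O := derivOracle d x f with hO
  set s₀ := (init learner d α x).state with hs₀
  have z00 : s₀.nat 0 0 = n := by simp [hs₀, init]
  have z01 : s₀.nat 0 1 = d := by simp [hs₀, init]
  have z (a : ℕ) (ha : a ≠ 0) (i : ℕ) : s₀.nat a i = 0 := by simp [hs₀, init, ha]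
  have zα : s₀.real 1 0 = α := by simp [hs₀, init]
  have zX : ∀ i (h : i < n), s₀.real 0 i = x ⟨i, h⟩ := fun i h => by simp [hs₀, init, h]
  have zb : s₀.batch = [] := rfl
  have zq : s₀.queries = 0 := rfl
  have zr : s₀.rounds = 0 := rfl
  have hL0 : 0 < L := by rw [hL]; exact Nat.clog_pos (by norm_num) hn
  have hκ0 : 0 < κ := by rw [hκ, Nat.ceil_pos]; positivity
  have hκL : κ ≤ L := by
    rw [hκ, Nat.ceil_le]
    exact mul_le_of_le_one_left (Nat.cast_nonneg L) hα1
  have hLn : L ≤ n := by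
    rw [hL, Nat.clog_le_iff_le_pow (by norm_num)]
    exact Nat.lt_two_pow_self.le
  have hR0 : 0 < L ⌈/⌉ κ := (lt_ceilDiv_iff hκ0).2 (by omega)
  have hlabel (v : ℕ) (hv : v < n) : O 0 v = signBit (f.eval (x ⟨v, hv⟩)) := by
    rw [hO, derivOracle, dif_pos ⟨hd, hv⟩]; rfl
  set R := L ⌈/⌉ κ with hR
  have hnR : n ≤ n * R := Nat.le_mul_of_pos_right _ hR0
  set srt := if StrictMono x then 0 else 72 * (n * L) with hsrt
  refine ((powers_spec (z 10 (by simp) 0)).andThen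
    (u := 1 + (2 * κ + 1) + (1 + (12 * n + 10 + srt + R * (100 * n + 21)))) fun s₁ h => ?_).le ?_
  swap
  · rw [z00, ← hL]
    have : R * (100 * n + 21) = 100 * (n * R) + 21 * R := by ring
    have : R ≤ n * R := Nat.le_mul_of_pos_left _ (by omega)
    omega
  rw [z00, ← hL] at h
  obtain ⟨hA₁, hb₁, h10, h6⟩ := h
  refine TerminatesIn.andThen ((exponent_spec (hA₁.nat 11 (by simp) ▸ z 11 (by simp) 0)).le ?_)
    fun s₂ h => ?_
  · rw [hA₁.real, zα, h10, ← hκ]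
  rw [hA₁.real, zα, h10, ← hκ] at h
  obtain ⟨hA₂, hb₂, h11⟩ := h
  have hA : Agrees [6, 10, 11] s₀ s₂ := ⟨fun a ha => by
    rw [hA₂.nat a (by simp at ha ⊢; tauto), hA₁.nat a (by simp at ha ⊢; tauto)],
    hA₂.real.trans hA₁.real, hA₂.queries.trans hA₁.queries, hA₂.rounds.trans hA₁.rounds⟩
  have g0 : s₂.nat 0 = s₀.nat 0 := hA.nat 0 (by simp)
  have g00 : s₂.nat 0 0 = n := by rw [g0, z00]
  have g6 : ∀ p ≤ L, s₂.nat 6 p = 2 ^ p := by rwa [hA₂.nat 6 (by simp)]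
  have g10 : s₂.nat 10 0 = L := by rw [hA₂.nat 10 (by simp), h10]
  have gb : s₂.batch = [] := hb₂.trans hb₁
  have gz (a : ℕ) (ha : a ∉ [0, 6, 10, 11]) (i : ℕ) : s₂.nat a i = 0 := by
    rw [hA.nat a (by simp at ha ⊢; tauto), z a (by simp at ha; tauto)]
  -- The test is evaluated in the reals because the machine does not multiply natural numbers.
  have hcond : BExp.holds s₂ (.leR (.times (.times (.times (.ofN .deg) (.ofN .deg)) (.ofN .deg))
      (.ofN (.cell 6 (.var 11)))) (.ofN .size)) ↔ d ^ 3 * 2 ^ κ ≤ n := by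
    simp only [BExp.holds, RExp.eval, NExp.eval, g0, z00, z01, h11, g6 κ hκL]
    rw [← Nat.cast_le (α := ℝ)]
    push_cast
    rw [pow_three, ← mul_assoc]
  refine TerminatesIn.ite (fun h => ?_) fun h => ?_
  · rw [hcond] at h
    refine ((identity_spec (gz 18 (by simp) 0) (gz 19 (by simp) 0)).andThen
      (u := 1 + (1 + (2 + srt)) + (R * (100 * n + 21) + 3)) fun s₃ h' => ?_).le ?_
    swap
    · rw [g00]; omega
    rw [g00] at h'
    obtain ⟨hA₃, hb₃, h4, h19⟩ := h'
    rw [hA.real] at h19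
    have hl₃ : Lists (s₃.nat 4) n :=
      ⟨fun i hi => by rwa [h4 i hi], fun v hv => ⟨v, hv, h4 v hv⟩⟩
    have key : TerminatesIn O (.ite (.leN (.lit 1) (.var 19)) mergeSort .skip) s₃
        (1 + (2 + srt)) fun s => Agrees [4, 5, 13, 18, 20, 21, 22, 23, 24, 25, 26] s₃ s ∧
          s.batch = s₃.batch ∧ Lists (s.nat 4) n ∧
          ∀ i j, i ≤ j → j < n → s₀.real 0 (s.nat 4 i) ≤ s₀.real 0 (s.nat 4 j) := by
      refine TerminatesIn.ite (fun hu => ?_) fun hu => ?_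
      · have hns : ¬ StrictMono x := by
          intro hx'
          have : s₃.nat 19 0 = 0 := h19.2 fun i hi => by
            rw [zX i (by omega), zX (i + 1) hi]
            exact hx'.monotone (by simp)
          simp [this] at hu
        refine (mergeSort_spec (by rw [hA₃.nat 0 (by simp), g00])
          (by rw [hA₃.nat 26 (by simp), gz 26 (by simp)]) (by rw [hA₃.nat 10 (by simp), g10, hL])
          (by rw [hA₃.nat 6 (by simp), ← hL]; exact g6) (by rw [hA₃.real, hA.real]) hl₃).le ?_
        rw [hsrt, if_neg hns, ← hL]
        nlinarith
      · refine (terminatesIn_skip ⟨.refl _ _, rfl, hl₃, fun i j hij hj => ?_⟩).le (by omega)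
        simp only [BExp.holds, NExp.eval, not_le, Nat.lt_one_iff] at hu
        rw [h4 i (by omega), h4 j hj]
        have hs := h19.1 hu
        induction j, hij using Nat.le_induction with
        | base => exact le_rfl
        | succ j hij ih => exact (ih (by omega)).trans (hs j hj)
    refine key.andThen fun s₄ h' => ?_
    obtain ⟨hA₄, hb₄, hl₄, hs₄⟩ := h'
    have hz := hl₄.strictMonoOn hx zX hs₄
    have k0 : s₄.nat 0 = s₀.nat 0 := by rw [hA₄.nat 0 (by simp), hA₃.nat 0 (by simp), g0]
    refine (search_spec (by rw [k0, z00]) (by rw [k0, z01]) hd hn hl₄ rfl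
      (by rw [hb₄, hb₃, gb]) hL
      (by rw [hA₄.nat 6 (by simp), hA₃.nat 6 (by simp)]; exact g6)
      (fun p => by rw [hA₄.nat 7 (by simp), hA₃.nat 7 (by simp), gz 7 (by simp)])
      (by rw [hA₄.nat 10 (by simp), hA₃.nat 10 (by simp), g10])
      (by rw [hA₄.nat 11 (by simp), hA₃.nat 11 (by simp), h11]) hκ0
      (inferable_derivOracle hf hd zX hl₄.1 hz) (fewChanges_derivOracle hf zX hl₄.1 hz) h).mono
      le_rfl ?_
    rintro s ⟨hlab, hq, hr⟩
    rw [hA₄.queries, hA₃.queries, hA.queries, zq, zero_add] at hq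
    rw [hA₄.rounds, hA₃.rounds, hA.rounds, zr, zero_add] at hr
    exact ⟨fun j => (hlab j j.2).trans (hlabel j j.2), hq, hr.le⟩
  · rw [hcond, not_le] at h
    refine (queryAll_spec (gz 18 (by simp) 0) gb).mono ?_ ?_
    · rw [g00]; omega
    · rintro s ⟨hlab, hq, hr⟩
      rw [g00] at hlab hq
      rw [hA.queries, zq, zero_add] at hq
      rw [hA.rounds, zr, zero_add] at hr
      refine ⟨fun j => (hlab j j.2).trans (hlabel j j.2), ?_, by omega⟩
      calc s.queries ≤ 1 * (6 * (d ^ 3 * 2 ^ κ)) := by omega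
        _ ≤ R * (6 * (d ^ 3 * 2 ^ κ)) := Nat.mul_le_mul_right _ hR0
        _ = _ := by ring

/-- Rounding the logarithm adds at most `α ≤ 1` to the exponent and rounding the product adds at
most `1`, whence the factor `2 ^ 2`. -/
theorem two_pow_ceil_le (hn : 0 < n) (hα : 0 ≤ α) (hα1 : α ≤ 1) :
    (2 : ℝ) ^ ⌈α * Nat.clog 2 n⌉₊ ≤ 4 * (n : ℝ) ^ α := by
  have hn' : (0 : ℝ) < n := by exact_mod_cast hn
  have hlog : 0 ≤ Real.logb 2 n := Real.logb_nonneg (by norm_num) (by exact_mod_cast hn)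
  have hL : (Nat.clog 2 n : ℝ) ≤ Real.logb 2 n + 1 := by
    have h1 := Nat.ceil_lt_add_one hlog
    have h2 := Real.natCeil_logb_natCast 2 n
    push_cast at h2
    rw [h2] at h1
    exact h1.le
  have hκ := Nat.ceil_lt_add_one (a := α * Nat.clog 2 n) (by positivity)
  calc (2 : ℝ) ^ ⌈α * Nat.clog 2 n⌉₊ = (2 : ℝ) ^ (⌈α * Nat.clog 2 n⌉₊ : ℝ) := by
        rw [Real.rpow_natCast]
    _ ≤ (2 : ℝ) ^ (Real.logb 2 n * α + 2) := by
        refine Real.rpow_le_rpow_of_exponent_le (by norm_num) ?_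
        nlinarith
    _ = 4 * (n : ℝ) ^ α := by
        rw [Real.rpow_add (by norm_num), Real.rpow_mul (by norm_num),
          Real.rpow_logb (by norm_num) (by norm_num) hn']
        norm_num; ring

end Learner

end RealRAM

/-! ### The final bounds and their constants -/

theorem mainTheorem2 :
    ∃ (P : RealRAM.Cmd) (C : ℝ), ∀ (d n : ℕ) (α : ℝ), 1 ≤ d → 2 ≤ n →
      1 / Real.logb 2 n < α → α ≤ 1 →
      ∀ x : Fin n → ℝ, Function.Injective x → ∀ f : Polynomial ℝ, f.natDegree ≤ d →
        RealRAM.LabelsPerfectly P d α x f ∧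
        RealRAM.expectedCost RealRAM.State.queries P d α x f ≤
          ENNReal.ofReal (C * ((d : ℝ) ^ 3 * (n : ℝ) ^ α / α)) ∧
        RealRAM.expectedCost RealRAM.State.rounds P d α x f ≤ ENNReal.ofReal (1 + 2 / α) ∧
        RealRAM.expectedCost RealRAM.State.time P d α x f ≤
          ENNReal.ofReal (C * (n * Real.logb 2 n)) ∧
        (StrictMono x →
          RealRAM.expectedCost RealRAM.State.time P d α x f ≤ ENNReal.ofReal (C * (n / α))) := by
  classical
  -- The queries need `2 * 6 * 4 = 48`, and the time needs at most `50 + 2 * 121 + 2 * 72 = 436`.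
  refine ⟨RealRAM.learner, 500, fun d n α hd hn hα hα1 x hx f hf => ?_⟩
  have hn' : (2 : ℝ) ≤ n := by exact_mod_cast hn
  have hlog1 : 1 ≤ Real.logb 2 n := by
    rw [Real.le_logb_iff_rpow_le (by norm_num) (by linarith)]
    simpa using hn'
  have hα0 : 0 < α := lt_trans (by positivity) hα
  -- The lower bound on `α` keeps the `n / α` time of the search within `n log n`.
  have hαlog : 1 / α ≤ Real.logb 2 n := by
    rw [div_le_comm₀ hα0 (by linarith)]; exact hα.le
  have h1α : 1 ≤ 1 / α := by rwa [one_le_div hα0]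
  set L := Nat.clog 2 n with hL
  set κ := ⌈α * L⌉₊ with hκ
  have hspec := RealRAM.learner_spec hd hn hα0 hα1 hx hf hL hκ
  have hL0 : 0 < L := by rw [hL]; exact Nat.clog_pos (by norm_num) hn
  have hκ0 : 0 < κ := by rw [hκ, Nat.ceil_pos]; positivity
  have hpow : (2 : ℝ) ^ κ ≤ 4 * (n : ℝ) ^ α := RealRAM.two_pow_ceil_le (by omega) hα0.le hα1
  have hLlog : (L : ℝ) ≤ 2 * Real.logb 2 n := by
    have h1 := Nat.ceil_lt_add_one (zero_le_one.trans hlog1)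
    have h2 := Real.natCeil_logb_natCast 2 n
    push_cast at h2
    rw [h2] at h1
    linarith
  -- Since `κ ≥ α * L`, the quotient `L / κ` is at most `1 / α`, and rounding it up adds at most
  -- `1`.
  have hR : ((L ⌈/⌉ κ : ℕ) : ℝ) ≤ 1 + 1 / α := by
    have h1 : ((L ⌈/⌉ κ : ℕ) : ℝ) * κ ≤ L + κ := by
      exact_mod_cast RealRAM.ceilDiv_mul_le L hκ0
    have h2 : α * L ≤ κ := Nat.le_ceil _
    have h3 : (0 : ℝ) < κ := by exact_mod_cast hκ0
    have h4 : (L : ℝ) ≤ 1 / α * κ := by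
      rw [div_mul_eq_mul_div, one_mul, le_div_iff₀ hα0]; linarith
    refine le_of_mul_le_mul_right ?_ h3
    linarith
  generalize L ⌈/⌉ κ = R at hspec hR
  have hR2 : (R : ℝ) ≤ 2 * (1 / α) := by linarith
  have cast_le {m : ℕ} {r : ℝ} (h : (m : ℝ) ≤ r) : (m : ℝ≥0∞) ≤ ENNReal.ofReal r := by
    rw [← ENNReal.ofReal_natCast]; exact ENNReal.ofReal_le_ofReal h
  have hnR : (n : ℝ) * R ≤ 2 * (n * (1 / α)) := by nlinarith
  have hn1 : (n : ℝ) ≤ n * (1 / α) := le_mul_of_one_le_right (by linarith) h1α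
  refine ⟨RealRAM.labelsPerfectly_of_terminatesIn hspec fun s h => h.1,
    (RealRAM.expectedCost_queries_le hspec fun s h => h.2.1).trans (cast_le ?_),
    (RealRAM.expectedCost_rounds_le hspec fun s h => h.2.2).trans (cast_le ?_),
    (RealRAM.expectedCost_time_le hspec).trans (cast_le ?_),
    fun hs => (RealRAM.expectedCost_time_le hspec).trans (cast_le ?_)⟩
  · push_cast
    calc (R : ℝ) * (6 * d ^ 3 * 2 ^ κ) ≤ (2 * (1 / α)) * (6 * d ^ 3 * (4 * (n : ℝ) ^ α)) := by
          gcongr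
      _ = 48 * ((d : ℝ) ^ 3 * (n : ℝ) ^ α / α) := by ring
      _ ≤ _ := by gcongr; norm_num
  · calc (R : ℝ) ≤ 1 + 1 / α := hR
      _ ≤ 1 + 2 / α := by gcongr; norm_num
  · have h1 : (n : ℝ) * (1 / α) ≤ n * Real.logb 2 n := by gcongr
    have h2 : (n : ℝ) * L ≤ 2 * (n * Real.logb 2 n) := by nlinarith
    have h3 : (0 : ℝ) ≤ n * L := by positivity
    split_ifs
    · push_cast; linarith
    · push_cast; linarith
  · rw [if_pos hs]
    push_cast
    rw [← mul_one_div (n : ℝ) α]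
    linarith
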